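/- For a group $H$ let $1=\mathcal Z_0(H)\le \mathcal Z_1(H)\le \mathcal Z_2(H)\le\cdots$ be its upper central series, put $\mathcal Z_\infty(H)=\bigcup_{n\in\mathbb N}\mathcal Z_n(H)$, and call $H$ hypercentral if $H=\mathcal Z_\infty(H)$. Theorem. Let $G$ be an arbitrary group, and let $\mathcal U_1(\mathbb ZG)$ be the group of units of augmentation one of the integral group ring $\mathbb ZG$. Then $\mathcal U_1(\mathbb ZG)$ is hypercentral if and only if $G$ is hypercentral, the elements of finite order of $G$ form a subgroup $T$, and $T$ satisfies at least one of the following conditions: (a) $T$ is central in $G$; (b) $T$ is an abelian $2$-group, and for every $g\in G$ there is $\delta(g)\in\{1,-1\}$ such that $g^{-1}tg=t^{\delta(g)}$ for all $t\in T$; (c) $T$ is an internal direct product $K_8\times E_2$, where $K_8$ is a quaternion group of order $8$, $E_2$ is an elementary abelian $2$-group (possibly trivial or infinite) that is central in $G$, and conjugation by each $g\in G$ induces on $K_8$ an inner automorphism of $K_8$. -/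

import Mathlib

namespace UnitHypercentral

/-- The hypercentre `Z_∞(H) = ⋃ n ∈ ℕ, Z_n(H)`: the union of the terms (of finite index) of the
upper central series of `H`. -/
def hypercenter (H : Type*) [Group H] : Set H :=
  ⋃ n : ℕ, (Subgroup.upperCentralSeries H n : Set H)

/-- `H` is hypercentral if `H = Z_∞(H)`. -/
def IsHypercentral (H : Type*) [Group H] : Prop :=
  hypercenter H = Set.univ

/-- The augmentation `ℤG → ℤ`, `∑ a_g g ↦ ∑ a_g`. -/
noncomputable def augmentation (G : Type*) [Group G] : MonoidAlgebra ℤ G →ₐ[ℤ] ℤ :=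
  MonoidAlgebra.lift ℤ ℤ G (1 : G →* ℤ)

/-- The augmentation is indeed the sum of the coefficients. -/
theorem augmentation_single (G : Type*) [Group G] (g : G) (a : ℤ) :
    augmentation G (MonoidAlgebra.single g a) = a := by
  simp [augmentation]

/-- `U₁(ℤG)`: the group of units of augmentation one of the integral group ring `ℤG`. -/
noncomputable def unitsOne (G : Type*) [Group G] : Subgroup (MonoidAlgebra ℤ G)ˣ :=
  (Units.map (augmentation G : MonoidAlgebra ℤ G →* ℤ)).ker

/-- An element of `(ℤG)ˣ` lies in `U₁(ℤG)` exactly when its augmentation is `1`. -/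
theorem mem_unitsOne (G : Type*) [Group G] (u : (MonoidAlgebra ℤ G)ˣ) :
    u ∈ unitsOne G ↔ augmentation G (u : MonoidAlgebra ℤ G) = 1 := by
  simp [unitsOne, MonoidHom.mem_ker, Units.ext_iff]

variable {G : Type*} [Group G]

/-- `T` is the torsion subgroup of `G`: its elements are exactly the elements of finite order. -/
def IsTorsionSubgroup (T : Subgroup G) : Prop :=
  ∀ g : G, g ∈ T ↔ IsOfFinOrder g

/-- `T` is an abelian `2`-group, and every `g ∈ G` acts on `T` by `t ↦ t ^ δ(g)`, where the sign
`δ(g) = ±1` depends only on `g`. -/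
def IsAbelianTwoGroupActedOnBySigns (T : Subgroup G) : Prop :=
  (∀ s ∈ T, ∀ t ∈ T, s * t = t * s) ∧ IsPGroup 2 T ∧
    ∃ δ : G → ℤ, (∀ g, δ g = 1 ∨ δ g = -1) ∧ ∀ g : G, ∀ t ∈ T, g⁻¹ * t * g = t ^ δ g

/-- `T = K × E` is an internal direct product, where `K` is a quaternion group of order `8`,
`E` is an elementary abelian `2`-group (possibly trivial or infinite) that is central in `G`, and
conjugation by each `g ∈ G` induces an inner automorphism of `K`. -/
def IsQuaternionTimesElementary (T : Subgroup G) : Prop :=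
  ∃ K E : Subgroup G,
    Nonempty (K ≃* QuaternionGroup 2) ∧ (∀ e ∈ E, e ^ 2 = 1) ∧ E ≤ Subgroup.center G ∧
    K ⊓ E = ⊥ ∧ K ⊔ E = T ∧
    ∀ g : G, ∃ k ∈ K, ∀ x ∈ K, g⁻¹ * x * g = k⁻¹ * x * k

end UnitHypercentral

/-! Both directions pass through one condition, `FixesOrInvertsTorsion`: conjugation by any g ∈ G
sends each torsion element t to t or t⁻¹.

Suppose the units are hypercentral, so that iterated commutators with a fixed unit must die. Let t̂
be the sum of the powers of t. The bicyclic units 1 + (1 - t)^(i+1) g t̂ form a commutator chain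
with t, and it can reach 1 only if g normalizes ⟨t⟩ (`exists_conj_eq_pow`). So g acts by t ↦ t^k,
unipotently on the normalized units of ℤ⟨t⟩; having finite order as well, it preserves every
additive invariant of them, such as log|χ(·)| for a faithful character χ. For Hoechsmann's unit,
with ζ = χ(t), this says that log|ζ^(k^i) - 1| has constant second difference in i. The sequence is
periodic, so that difference is zero. Since |ζ - 1| is the shortest chord, k ≡ ±1 modulo the order
of t (`eq_or_eq_inv_of_conj_eq_pow`). Elementary group theory then turns the condition, together
with hypercentrality of G, into the three cases (`torsion_structure`).

Conversely, under the condition, elements supported on T and self-adjoint for the involution g ↦ g⁻¹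
are central in ℤG. Hence homogeneous elements of the G/T-grading with square zero vanish. Since G/T
is torsion-free hypercentral, it can be ordered, and a leading-term argument makes every unit
homogeneous (`exists_homog_of_mul_eq_one`). For homogeneous u the element u u* is central, so a
commutator v of normalized units satisfies v v* = 1 and is an element of G
(`exists_commutator_eq_toUnitsOne`). Commutators can then be followed along the central series of G.
Because the series has only finite indices, this needs a single m with t² ∈ Z_m(G) for all t ∈ T
(`isHypercentral_unitsOne`). -/

namespace UnitHypercentral

open scoped MonoidAlgebra commutatorElement

/-! ### The canonical involution and its positivity. -/

section Star
variable {G : Type*} [Group G]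

/-- The canonical anti-involution of `ℤ[G]`, inverting the elements of `G`. -/
noncomputable def conj (a : ℤ[G]) : ℤ[G] := MonoidAlgebra.mapDomain (fun g : G => g⁻¹) a

@[simp] lemma coeff_conj (a : ℤ[G]) (g : G) : (conj a).coeff g = a.coeff g⁻¹ := by
  have := Finsupp.mapDomain_equiv_apply (f := Equiv.inv G) a.coeff g
  simpa [conj, MonoidAlgebra.mapDomain] using this

@[simp] lemma conj_single (g : G) (n : ℤ) :
    conj (MonoidAlgebra.single g n) = MonoidAlgebra.single g⁻¹ n := by
  simp [conj]

@[simp] lemma conj_conj (a : ℤ[G]) : conj (conj a) = a := by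
  ext g; simp

@[simp] lemma conj_add (a b : ℤ[G]) : conj (a + b) = conj a + conj b := by
  ext g; simp

@[simp] lemma conj_sub (a b : ℤ[G]) : conj (a - b) = conj a - conj b := by
  ext g; simp

@[simp] lemma conj_zero : conj (0 : ℤ[G]) = 0 := by
  ext g; simp

@[simp] lemma conj_one : conj (1 : ℤ[G]) = 1 := by
  simp [MonoidAlgebra.one_def]

lemma conj_eq_zero {a : ℤ[G]} (h : conj a = 0) : a = 0 := by
  rw [← conj_conj a, h, conj_zero]

@[simp] lemma conj_mul (a b : ℤ[G]) : conj (a * b) = conj b * conj a := by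
  induction a using MonoidAlgebra.induction_linear with
  | zero => simp
  | add a a' h h' => simp [add_mul, mul_add, h, h']
  | single g n =>
    induction b using MonoidAlgebra.induction_linear with
    | zero => simp
    | add b b' h h' => simp [add_mul, mul_add, h, h']
    | single g' n' => simp [MonoidAlgebra.single_mul_single, mul_comm]

lemma coeff_mul_conj_one (a : ℤ[G]) :
    (a * conj a).coeff 1 = a.coeff.sum fun _ n => n ^ 2 := by
  rw [MonoidAlgebra.coeff_mul_apply_left]
  simp [sq, Finsupp.sum]

/-- The form (a a*)(1) is a sum of integer squares, hence positive definite. This is the source of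
every vanishing statement below. -/
lemma eq_zero_of_mul_conj {a : ℤ[G]} (h : a * conj a = 0) : a = 0 := by
  have h1 := coeff_mul_conj_one a
  rw [h] at h1
  ext g
  by_contra hg
  rw [MonoidAlgebra.coeff_zero, Finsupp.zero_apply] at hg
  have h2 : a.coeff g ^ 2 ≤ a.coeff.sum fun _ n => n ^ 2 :=
    Finset.single_le_sum (f := fun g => a.coeff g ^ 2) (fun _ _ => sq_nonneg _)
      (Finsupp.mem_support_iff.2 hg)
  rw [← h1] at h2
  have : 0 < a.coeff g ^ 2 := by positivity
  simp at h2
  omega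

lemma eq_zero_of_conj_mul {a : ℤ[G]} (h : conj a * a = 0) : a = 0 :=
  conj_eq_zero (eq_zero_of_mul_conj (by simpa using h))

/-- An element with `a a* = 1` is a group element up to sign. -/
lemma exists_eq_single_of_mul_conj {a : ℤ[G]} (h : a * conj a = 1) :
    ∃ (g : G) (n : ℤ), a = MonoidAlgebra.single g n := by
  classical
  have h1 := coeff_mul_conj_one a
  rw [h] at h1
  simp only [MonoidAlgebra.one_def, MonoidAlgebra.coeff_single, Finsupp.single_eq_same] at h1
  have hne : a.coeff.support.Nonempty := by
    rw [Finset.nonempty_iff_ne_empty]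
    intro h0
    rw [Finsupp.sum, h0] at h1
    simp at h1
  obtain ⟨g, hg⟩ := hne
  refine ⟨g, a.coeff g, ?_⟩
  ext x
  by_cases hx : x = g
  · subst hx; simp
  · rw [MonoidAlgebra.coeff_single, Finsupp.single_eq_of_ne hx]
    by_contra hxa
    have h2 : a.coeff g ^ 2 + a.coeff x ^ 2 ≤ a.coeff.sum fun _ n => n ^ 2 := by
      rw [Finsupp.sum, ← Finset.sum_pair (f := fun g => a.coeff g ^ 2) (Ne.symm hx)]
      refine Finset.sum_le_sum_of_subset_of_nonneg ?_ fun _ _ _ => sq_nonneg _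
      intro y hy
      simp only [Finset.mem_insert, Finset.mem_singleton] at hy
      rcases hy with rfl | rfl
      · exact hg
      · exact Finsupp.mem_support_iff.2 hxa
    have h3 : 0 < a.coeff x ^ 2 := by positivity
    have h4 : 0 < a.coeff g ^ 2 := by
      have := Finsupp.mem_support_iff.1 hg
      positivity
    omega

/-- A self-adjoint idempotent of `ℤ[G]` is trivial. -/
lemma idempotent_trivial {e : ℤ[G]} (h : e * e = e) (hs : conj e = e) : e = 0 ∨ e = 1 := by
  classical
  -- Since e = e e*, its coefficient at 1 is the sum of the squares of all coefficients. Over ℤ this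
  -- leaves no room for a nonzero coefficient elsewhere.
  have h1 := coeff_mul_conj_one e
  rw [hs, h] at h1
  have key : ∀ x ∈ e.coeff.support, x = 1 := by
    intro x hx
    by_contra hx1
    have h3 : 0 < e.coeff x ^ 2 := by
      have := Finsupp.mem_support_iff.1 hx
      positivity
    by_cases h0 : e.coeff 1 = 0
    · rw [h0] at h1
      have h2 : e.coeff x ^ 2 ≤ e.coeff.sum fun _ n => n ^ 2 :=
        Finset.single_le_sum (f := fun g => e.coeff g ^ 2) (fun _ _ => sq_nonneg _) hx
      omega
    · have h2 : e.coeff 1 ^ 2 + e.coeff x ^ 2 ≤ e.coeff.sum fun _ n => n ^ 2 := by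
        rw [Finsupp.sum, ← Finset.sum_pair (f := fun g => e.coeff g ^ 2) (Ne.symm hx1)]
        refine Finset.sum_le_sum_of_subset_of_nonneg ?_ fun _ _ _ => sq_nonneg _
        intro y hy
        simp only [Finset.mem_insert, Finset.mem_singleton] at hy
        rcases hy with rfl | rfl
        · exact Finsupp.mem_support_iff.2 h0
        · exact hx
      nlinarith [Int.le_self_sq (e.coeff 1)]
  have he : e = MonoidAlgebra.single 1 (e.coeff 1) := by
    ext x
    by_cases hx : x = 1
    · subst hx; simp
    · rw [MonoidAlgebra.coeff_single, Finsupp.single_eq_of_ne hx]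
      by_contra h0
      exact hx (key x (Finsupp.mem_support_iff.2 h0))
  have h2 : e.coeff 1 * e.coeff 1 = e.coeff 1 := by
    have := congrArg (fun a : ℤ[G] => a.coeff 1) h
    rw [he] at this
    simpa [MonoidAlgebra.single_mul_single] using this
  have h3 : e.coeff 1 = 0 ∨ e.coeff 1 = 1 := by
    rcases eq_or_ne (e.coeff 1) 0 with h0 | h0
    · exact .inl h0
    · exact .inr (mul_left_cancel₀ h0 (by rw [h2, mul_one]))
  rcases h3 with h0 | h0
  · left; rw [he, h0]; simp
  · right; rw [he, h0]; rfl

end Star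

/-! ### Gradings by an ordered group and homogeneity of units. -/

section Homogeneous
variable {G Γ : Type*} [Group G] [Group Γ] {φ : G →* Γ}

/-- `a` is supported on the fibre of `φ` over `x`. -/
def Homog (φ : G →* Γ) (x : Γ) (a : ℤ[G]) : Prop := ∀ g, a.coeff g ≠ 0 → φ g = x

lemma Homog.mul {x y : Γ} {a b : ℤ[G]} (ha : Homog φ x a) (hb : Homog φ y b) :
    Homog φ (x * y) (a * b) := by
  intro g hg
  rw [MonoidAlgebra.coeff_mul_apply_left] at hg
  obtain ⟨h, -, hh⟩ := Finset.exists_ne_zero_of_sum_ne_zero hg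
  rw [← ha h (left_ne_zero_of_mul hh), ← hb _ (right_ne_zero_of_mul hh), ← map_mul]
  simp

lemma Homog.map_conj {x : Γ} {a : ℤ[G]} (ha : Homog φ x a) : Homog φ x⁻¹ (conj a) := by
  intro g hg
  rw [coeff_conj] at hg
  rw [← ha _ hg]; simp

lemma Homog.sub {x : Γ} {a b : ℤ[G]} (ha : Homog φ x a) (hb : Homog φ x b) :
    Homog φ x (a - b) := by
  intro g hg
  by_cases h : a.coeff g = 0
  · refine hb g fun h' => hg ?_
    simp [h, h']
  · exact ha g h

lemma homog_single (g : G) (n : ℤ) : Homog φ (φ g) (MonoidAlgebra.single g n) := by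
  intro h hh
  by_cases e : h = g
  · rw [e]
  · simp [e] at hh

lemma homog_one : Homog φ 1 (1 : ℤ[G]) := by
  simpa [MonoidAlgebra.one_def] using homog_single (φ := φ) (1 : G) 1

open Classical in
/-- The homogeneous component of `a` over `x`. -/
noncomputable def component (φ : G →* Γ) (x : Γ) : ℤ[G] →+ ℤ[G] where
  toFun a := .ofCoeff (a.coeff.filter fun g => φ g = x)
  map_zero' := by rw [MonoidAlgebra.coeff_zero, Finsupp.filter_zero]; rfl
  map_add' a b := by ext; simp [Finsupp.filter_add]

open Classical in
lemma coeff_component (x : Γ) (a : ℤ[G]) (g : G) :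
    (component φ x a).coeff g = if φ g = x then a.coeff g else 0 := by
  simp [component, Finsupp.filter_apply]

lemma homog_component (x : Γ) (a : ℤ[G]) : Homog φ x (component φ x a) := by
  intro g hg
  by_contra h
  simp [coeff_component, h] at hg

open Classical in
lemma sum_component {a : ℤ[G]} {X : Finset Γ} (hX : a.coeff.support.image φ ⊆ X) :
    ∑ x ∈ X, component φ x a = a := by
  ext g
  simp only [MonoidAlgebra.coeff_sum, Finsupp.finsetSum_apply, coeff_component]
  by_cases h : a.coeff g = 0
  · simp [h]
  · rw [Finset.sum_ite_eq, if_pos (hX (Finset.mem_image_of_mem _ (Finsupp.mem_support_iff.2 h)))]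

lemma component_eq_zero {a : ℤ[G]} {X : Finset Γ} [DecidableEq Γ]
    (hX : a.coeff.support.image φ ⊆ X)
    {x : Γ} (hx : x ∉ X) : component φ x a = 0 := by
  ext g
  rw [coeff_component]
  split_ifs with h
  · by_contra h0
    exact hx (h ▸ hX (Finset.mem_image_of_mem _ (Finsupp.mem_support_iff.2 h0)))
  · rfl

lemma component_homog_mul {x : Γ} {a : ℤ[G]} (ha : Homog φ x a) (p : Γ) (b : ℤ[G]) :
    component φ p (a * b) = a * component φ (x⁻¹ * p) b := by
  ext g
  rw [coeff_component, MonoidAlgebra.coeff_mul_apply_left, MonoidAlgebra.coeff_mul_apply_left]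
  simp only [Finsupp.sum]
  have : ∀ (q : Prop) [Decidable q] (s : Finset G) (f : G → ℤ),
      (if q then ∑ x ∈ s, f x else 0) = ∑ x ∈ s, if q then f x else 0 := by
    intro q _ s f; split_ifs <;> simp
  rw [this]
  refine Finset.sum_congr rfl fun h hh => ?_
  have := ha h (Finsupp.mem_support_iff.1 hh)
  rw [coeff_component]
  have e : φ (h⁻¹ * g) = x⁻¹ * p ↔ φ g = p := by rw [map_mul, map_inv, this, mul_right_inj]
  by_cases hg : φ g = p
  · rw [if_pos hg, if_pos (e.2 hg)]
  · rw [if_neg hg, if_neg (mt e.1 hg), mul_zero]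

open Classical in
lemma component_mul {a : ℤ[G]} {X : Finset Γ} (hX : a.coeff.support.image φ ⊆ X)
    (p : Γ) (b : ℤ[G]) :
    component φ p (a * b) = ∑ x ∈ X, component φ x a * component φ (x⁻¹ * p) b := by
  conv_lhs => rw [← sum_component hX, Finset.sum_mul, map_sum]
  exact Finset.sum_congr rfl fun x _ => component_homog_mul (homog_component x a) p b

/-- The positive elements of a two-sided invariant total order. -/
structure IsOrderCone (P : Set Γ) : Prop where
  one_notMem : (1 : Γ) ∉ P
  mul_mem : ∀ x ∈ P, ∀ y ∈ P, x * y ∈ P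
  conj_mem : ∀ g, ∀ x ∈ P, g * x * g⁻¹ ∈ P
  total : ∀ x, x ∈ P ∨ x = 1 ∨ x⁻¹ ∈ P

lemma IsOrderCone.inv {P : Set Γ} (hP : IsOrderCone P) : IsOrderCone P⁻¹ where
  one_notMem := by simpa using hP.one_notMem
  mul_mem x hx y hy := by
    simp only [Set.mem_inv, mul_inv_rev] at *
    exact hP.mul_mem _ hy _ hx
  conj_mem g x hx := by
    simp only [Set.mem_inv] at *
    simpa [mul_assoc] using hP.conj_mem g _ hx
  total x := by
    rcases hP.total x with h | h | h
    · right; right; simpa using h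
    · right; left; exact h
    · left; simpa using h

lemma IsOrderCone.exists_max {P : Set Γ} (hP : IsOrderCone P) {ι : Type*} (s : Set ι)
    (hs : s.Finite) (hne : s.Nonempty) (f : ι → Γ) :
    ∃ m ∈ s, ∀ i ∈ s, f i = f m ∨ (f i)⁻¹ * f m ∈ P := by
  classical
  induction s, hs using Set.Finite.induction_on with
  | empty => exact absurd hne (by simp)
  | @insert i s _ _ ih =>
    rcases s.eq_empty_or_nonempty with rfl | hs
    · exact ⟨i, by simp, by simp⟩
    obtain ⟨m, hm, h⟩ := ih hs
    rcases hP.total ((f i)⁻¹ * f m) with h1 | h1 | h1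
    · refine ⟨m, .inr hm, ?_⟩
      rintro j (rfl | hj)
      · exact .inr h1
      · exact h j hj
    · refine ⟨m, .inr hm, ?_⟩
      rintro j (rfl | hj)
      · exact .inl (inv_mul_eq_one.1 h1)
      · exact h j hj
    · refine ⟨i, .inl rfl, ?_⟩
      rintro j (rfl | hj)
      · exact .inl rfl
      · right
        simp only [mul_inv_rev, inv_inv] at h1
        rcases h j hj with h2 | h2
        · rwa [h2]
        · simpa [mul_assoc] using hP.mul_mem _ h2 _ h1

/-- Homogeneous elements of square zero vanish. -/
def HomogReduced (φ : G →* Γ) : Prop := ∀ (x : Γ) (a : ℤ[G]), Homog φ x a → a * a = 0 → a = 0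

/-- Here (ba)² = b(ab)a = 0, and ba is homogeneous. -/
lemma Homog.mul_eq_zero_comm (hsq : HomogReduced φ) {x y : Γ} {a b : ℤ[G]} (ha : Homog φ x a) (hb : Homog φ y b)
    (h : a * b = 0) : b * a = 0 := by
  refine hsq _ _ (hb.mul ha) ?_
  rw [mul_assoc, ← mul_assoc a, h]; simp

/-- A leading-term argument without cancellation. Among the nonzero products of components of
positive degree, take the largest degree p, then the smallest left degree r.1 occurring for p. The
degree p part of uv = 1 vanishes. Multiplying it on the left by v_{r.2} leaves only the r-term: left
degrees below r.1 contribute zero by minimality, and for those above r.1 the product u_{x'} v_{r.2}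
has degree beyond p. The result v u v = 0 makes (uv)² = 0 for these two components, a contradiction.
-/
lemma component_mul_component_of_pos (hsq : HomogReduced φ) {P : Set Γ} (hP : IsOrderCone P) {u v : ℤ[G]}
    (h : u * v = 1) {x y : Γ} (hxy : x * y ∈ P) : component φ x u * component φ y v = 0 := by
  classical
  by_contra hne
  set s : Set (Γ × Γ) := {q | component φ q.1 u * component φ q.2 v ≠ 0 ∧ q.1 * q.2 ∈ P} with hs
  have hfin : s.Finite := by
    refine ((u.coeff.support.image φ ×ˢ v.coeff.support.image φ).finite_toSet).subset ?_
    rintro ⟨a, b⟩ ⟨h1, -⟩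
    rw [Finset.mem_coe, Finset.mem_product]
    constructor
    · by_contra h2
      exact h1 (by rw [component_eq_zero subset_rfl h2, zero_mul])
    · by_contra h2
      exact h1 (by rw [component_eq_zero subset_rfl h2, mul_zero])
  obtain ⟨q, hq, hmax⟩ := hP.exists_max s hfin ⟨(x, y), hne, hxy⟩ fun q => q.1 * q.2
  set p := q.1 * q.2 with hp
  -- A maximum for the inverse cone is a minimum for `P`.
  obtain ⟨r, ⟨hr, hrp⟩, hmin⟩ := hP.inv.exists_max {r | r ∈ s ∧ r.1 * r.2 = p}
    (hfin.subset fun r hr => hr.1) ⟨q, hq, rfl⟩ fun r => r.1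
  have hp1 : p ≠ 1 := fun e => hP.one_notMem (e ▸ hq.2)
  have hsum := component_mul (φ := φ) (X := insert r.1 (u.coeff.support.image φ))
    (Finset.subset_insert _ _) p v
  have h1 : component φ p (1 : ℤ[G]) = 0 := by
    ext g
    rw [coeff_component]
    split_ifs with hg
    · rw [MonoidAlgebra.one_def, MonoidAlgebra.coeff_single, Finsupp.single_eq_of_ne]
      · rfl
      · rintro rfl; exact hp1 (by rw [← hg, map_one])
    · rfl
  rw [h, h1] at hsum
  have hr2 : r.1⁻¹ * p = r.2 := by rw [← hrp]; group
  have hzero : component φ r.2 v * component φ r.1 u * component φ r.2 v = 0 := by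
    have h2 := congrArg (component φ r.2 v * ·) hsum
    simp only [mul_zero, Finset.mul_sum] at h2
    rw [Finset.sum_eq_single r.1, hr2, ← mul_assoc] at h2
    · exact h2.symm
    · intro x' _ hx'
      by_contra h3
      have h4 : component φ x' u * component φ (x'⁻¹ * p) v ≠ 0 := right_ne_zero_of_mul h3
      have h5 : (x', x'⁻¹ * p) ∈ s := ⟨h4, by simpa using hq.2⟩
      rcases hmin _ ⟨h5, by simp⟩ with h6 | h6
      · exact hx' h6
      · have h7 : r.1⁻¹ * x' ∈ P := by simpa using h6
        have h8 : component φ x' u * component φ r.2 v = 0 := by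
          by_contra h9
          have h10 : x' * r.2 = p * (r.2⁻¹ * (r.1⁻¹ * x') * r.2) := by rw [← hrp]; group
          have h11 := hP.conj_mem r.2⁻¹ _ h7
          rw [inv_inv] at h11
          have h12 : ((x', r.2) : Γ × Γ) ∈ s := ⟨h9, by
            show x' * r.2 ∈ P
            rw [h10]
            exact hP.mul_mem _ hq.2 _ h11⟩
          rcases hmax _ h12 with h13 | h13
          · have : r.2⁻¹ * (r.1⁻¹ * x') * r.2 = 1 := by
              have : p * (r.2⁻¹ * (r.1⁻¹ * x') * r.2) = p := by rw [← h10]; exact h13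
              simpa using this
            rw [this] at h11
            exact hP.one_notMem h11
          · have h14 := hP.mul_mem _ h13 _ h11
            have h15 : (x' * r.2)⁻¹ * p * (r.2⁻¹ * (r.1⁻¹ * x') * r.2) = 1 := by
              rw [mul_assoc, ← h10]; group
            exact hP.one_notMem (h15 ▸ h14)
        rw [← mul_assoc, Homog.mul_eq_zero_comm hsq (homog_component _ _) (homog_component _ _) h8,
          zero_mul] at h3
        exact h3 rfl
    · intro h2
      exact absurd (Finset.mem_insert_self _ _) h2
  refine hr.1 (hsq _ _ ((homog_component _ _).mul (homog_component _ _)) ?_)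
  rw [mul_assoc, ← mul_assoc (component φ r.2 v), hzero, mul_zero]

lemma component_mul_component_of_ne_one (hsq : HomogReduced φ) {P : Set Γ} (hP : IsOrderCone P) {u v : ℤ[G]}
    (h : u * v = 1) {x y : Γ} (hxy : x * y ≠ 1) : component φ x u * component φ y v = 0 := by
  rcases hP.total (x * y) with h1 | h1 | h1
  · exact component_mul_component_of_pos hsq hP h h1
  · exact absurd h1 hxy
  · exact component_mul_component_of_pos hsq hP.inv h h1

/-- An idempotent supported on the kernel of the grading is trivial. -/
lemma Homog.idempotent_trivial (hsq : HomogReduced φ) {e : ℤ[G]} (he : Homog φ 1 e) (h : e * e = e) :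
    e = 0 ∨ e = 1 := by
  -- Both er - ere and re - ere have square zero, so er = ere = re. In particular e commutes with
  -- e*, and a = e - ee* then satisfies aa* = 0, so that e is self-adjoint.
  have hcomm : ∀ r, Homog φ 1 r → e * r = r * e := by
    intro r hr
    have h1 : e * r - e * r * e = 0 := by
      refine hsq 1 _ (.sub (by simpa using he.mul hr) (by simpa using (he.mul hr).mul he)) ?_
      have : (e * r - e * r * e) * (e * r - e * r * e) =
        e * r * (e * r) - e * r * (e * r) * e - e * r * (e * e) * r + e * r * (e * e) * r * e := by
        noncomm_ring
      rw [this, h]; noncomm_ring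
    have h2 : r * e - e * r * e = 0 := by
      refine hsq 1 _ (.sub (by simpa using hr.mul he) (by simpa using (he.mul hr).mul he)) ?_
      have : (r * e - e * r * e) * (r * e - e * r * e) =
        r * e * (r * e) - r * (e * e) * (r * e) - e * r * e * (r * e)
          + e * r * (e * e) * r * e := by
        noncomm_ring
      rw [this, h]; noncomm_ring
    rw [sub_eq_zero.1 h1, sub_eq_zero.1 h2]
  have hc : Homog φ 1 (conj e) := by simpa using he.map_conj
  have h1 : e - e * conj e = 0 := by
    apply eq_zero_of_mul_conj
    have h2 := congrArg conj h
    rw [conj_mul] at h2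
    have h3 := hcomm _ hc
    simp only [conj_sub, conj_mul, conj_conj]
    rw [sub_mul, mul_sub, mul_sub, mul_assoc e (conj e) (conj e), h2, ← mul_assoc (e * conj e),
      mul_assoc e (conj e) e, ← h3, ← mul_assoc e e, h]
    rw [mul_assoc e (conj e) (conj e), h2]
    simp
  refine UnitHypercentral.idempotent_trivial h ?_
  rw [sub_eq_zero.1 h1]; simp

/-- Over an ordered quotient, every unit is homogeneous. -/
theorem exists_homog_of_mul_eq_one (hsq : HomogReduced φ) {P : Set Γ} (hP : IsOrderCone P) {u v : ℤ[G]}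
    (h : u * v = 1) : ∃ x, Homog φ x u := by
  classical
  have h1 := component_mul (φ := φ) (a := u) subset_rfl 1 v
  have h2 : component φ (1 : Γ) (1 : ℤ[G]) = 1 := by
    ext g
    rw [coeff_component]
    split_ifs with hg
    · rfl
    · rw [MonoidAlgebra.one_def, MonoidAlgebra.coeff_single, Finsupp.single_eq_of_ne]
      rintro rfl; exact hg (map_one φ)
  rw [h, h2] at h1
  simp only [mul_one] at h1
  obtain ⟨x, -, hx⟩ := Finset.exists_ne_zero_of_sum_ne_zero (h1 ▸ one_ne_zero)
  -- The products u_y v_{y⁻¹} sum to 1 and annihilate one another, so they are idempotents of degree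
  -- 1. One of them is nonzero, hence equal to 1, and it kills every other component of u.
  have hid : ∀ y, (component φ y u * component φ y⁻¹ v) * (component φ y u * component φ y⁻¹ v)
      = component φ y u * component φ y⁻¹ v := by
    intro y
    have hh : component φ y u * component φ y⁻¹ v =
        ∑ x ∈ u.coeff.support.image φ, (component φ x u * component φ x⁻¹ v) *
          (component φ y u * component φ y⁻¹ v) := by
      rw [← Finset.sum_mul, ← h1, one_mul]
    by_cases hy : y ∈ u.coeff.support.image φ
    · rw [Finset.sum_eq_single_of_mem y hy] at hh
      · exact hh.symm
      · intro z _ hz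
        rw [mul_assoc, ← mul_assoc (component φ z⁻¹ v), Homog.mul_eq_zero_comm hsq
          (homog_component _ _) (homog_component _ _)
          (component_mul_component_of_ne_one hsq hP h (x := y) (y := z⁻¹) ?_)]
        · simp
        · rw [Ne, mul_inv_eq_one]; exact hz.symm
    · simp [component_eq_zero subset_rfl hy]
  have hone : component φ x u * component φ x⁻¹ v = 1 := by
    refine ((Homog.idempotent_trivial hsq ?_ (hid x)).resolve_left hx)
    simpa using (homog_component x u).mul (homog_component x⁻¹ v)
  refine ⟨x, fun g hg => ?_⟩
  by_contra hgx
  have h3 := Homog.mul_eq_zero_comm hsq (homog_component _ _) (homog_component _ _)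
    (component_mul_component_of_ne_one hsq hP h (x := φ g) (y := x⁻¹)
      (by rwa [Ne, mul_inv_eq_one]))
  have h4 : component φ (φ g) u = 0 := by
    rw [← one_mul (component φ (φ g) u), ← hone, mul_assoc, h3, mul_zero]
  apply hg
  have := coeff_component (φ := φ) (φ g) u g
  simpa [h4] using this.symm

end Homogeneous

/-! ### Invariant orders on torsion-free hypercentral groups. -/

section Order

/-- A torsion-free commutative group has a total order cone. -/
lemma exists_isOrderCone_of_comm {A : Type*} [Group A]
    (hcomm : ∀ a b : A, a * b = b * a)
    (htf : ∀ (a : A) (n : ℕ), n ≠ 0 → a ^ n = 1 → a = 1) : ∃ P : Set A, IsOrderCone P := by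
  let _ : CommGroup A := { ‹Group A› with mul_comm := hcomm }
  -- A maximal submonoid without nontrivial units is the cone of elements ≥ 1. If x lies outside it,
  -- adjoining x must create a unit, which puts some negative power of x inside.
  obtain ⟨M, hM⟩ : ∃ M : Submonoid A, Maximal (fun M : Submonoid A => ∀ a ∈ M, a⁻¹ ∈ M → a = 1) M := by
    obtain ⟨M, -, hM⟩ := zorn_le_nonempty₀ {M : Submonoid A | ∀ a ∈ M, a⁻¹ ∈ M → a = 1} (by
      intro c hc hchain y hy
      have hd : DirectedOn (· ≤ ·) c := hchain.directedOn
      refine ⟨sSup c, ?_, fun z hz => le_sSup hz⟩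
      intro a ha ha'
      rw [Submonoid.mem_sSup_of_directedOn ⟨y, hy⟩ hd] at ha ha'
      obtain ⟨s, hs, has⟩ := ha
      obtain ⟨s', hs', has'⟩ := ha'
      obtain ⟨t, ht, h1, h2⟩ := hd s hs s' hs'
      exact hc ht a (h1 has) (h2 has')) ⊥ (by
        intro a ha _
        exact Submonoid.mem_bot.1 ha)
    exact ⟨M, hM⟩
  have step : ∀ x, x ∉ M → ∃ n : ℕ, n ≠ 0 ∧ (x ^ n)⁻¹ ∈ M := by
    intro x hx
    by_contra! hcon
    have hle : M ≤ M ⊔ Submonoid.powers x := le_sup_left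
    have : M ⊔ Submonoid.powers x ≤ M := by
      refine hM.2 ?_ hle
      intro a ha ha'
      rw [Submonoid.mem_sup] at ha ha'
      obtain ⟨p, hp, _, ⟨i, rfl⟩, rfl⟩ := ha
      obtain ⟨q, hq, _, ⟨j, rfl⟩, hqj⟩ := ha'
      simp only at hqj ⊢
      have h1 : (x ^ (i + j))⁻¹ = p * q := by
        have : q = (p * x ^ i)⁻¹ * (x ^ j)⁻¹ := by rw [← hqj]; group
        rw [this, pow_add]
        simp only [mul_inv]
        rw [mul_comm p⁻¹, ← mul_assoc, ← mul_assoc, mul_comm p, mul_assoc (x ^ i)⁻¹, mul_inv_cancel]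
        simp
      have h2 : i + j = 0 := by
        by_contra h
        exact hcon _ h (h1 ▸ M.mul_mem hp hq)
      obtain ⟨rfl, rfl⟩ : i = 0 ∧ j = 0 := by omega
      simp only [pow_zero, mul_one] at hqj ⊢
      exact hM.1 p hp (hqj ▸ hq)
    exact hx (this (Submonoid.mem_sup_right (Submonoid.mem_powers x)))
  refine ⟨{a | a ∈ M ∧ a ≠ 1}, ?_, ?_, ?_, ?_⟩
  · simp
  · rintro x ⟨hx, hx1⟩ y ⟨hy, hy1⟩
    refine ⟨M.mul_mem hx hy, fun h => hx1 (hM.1 x hx ?_)⟩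
    rwa [inv_eq_of_mul_eq_one_right h]
  · rintro g x hx
    simpa using hx
  · intro x
    by_contra! hcon
    obtain ⟨h1, h2, h3⟩ := hcon
    have hx : x ∉ M := fun h => h1 ⟨h, h2⟩
    have hx' : x⁻¹ ∉ M := fun h => h3 ⟨h, by simpa using h2⟩
    obtain ⟨n, hn, hn'⟩ := step x hx
    obtain ⟨m, hm, hm'⟩ := step x⁻¹ hx'
    refine h2 (htf x (n * m) (mul_ne_zero hn hm) ?_)
    refine hM.1 _ ?_ ?_
    · rw [mul_comm, pow_mul]
      simpa using pow_mem hm' n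
    · rw [pow_mul, ← inv_pow]
      exact pow_mem hn' m

variable {Γ : Type*} [Group Γ]

lemma mem_hypercenter_iff {x : Γ} :
    x ∈ hypercenter Γ ↔ ∃ n, x ∈ Subgroup.upperCentralSeries Γ n := by
  simp [hypercenter]

lemma IsHypercentral.exists_mem (h : IsHypercentral Γ) (x : Γ) :
    ∃ n, x ∈ Subgroup.upperCentralSeries Γ n :=
  mem_hypercenter_iff.1 (h ▸ Set.mem_univ x)

lemma mem_upperCentralSeries_succ_iff_mk {n : ℕ} {x : Γ} :
    x ∈ Subgroup.upperCentralSeries Γ (n + 1) ↔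
      (x : Γ ⧸ Subgroup.upperCentralSeries Γ n) ∈
        Subgroup.center (Γ ⧸ Subgroup.upperCentralSeries Γ n) := by
  have := Subgroup.upperCentralSeriesStep_eq_comap_center (Subgroup.upperCentralSeries Γ n)
  change x ∈ Subgroup.upperCentralSeriesStep (Subgroup.upperCentralSeries Γ n) ↔ _
  rw [this]; rfl

/-- The factors of the upper central series of a torsion-free group are torsion-free. -/
lemma mem_upperCentralSeries_of_pow_mem (htf : ∀ (a : Γ) (n : ℕ), n ≠ 0 → a ^ n = 1 → a = 1)
    (n : ℕ) : ∀ (x : Γ) (k : ℕ), k ≠ 0 → x ∈ Subgroup.upperCentralSeries Γ (n + 1) →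
      x ^ k ∈ Subgroup.upperCentralSeries Γ n → x ∈ Subgroup.upperCentralSeries Γ n := by
  induction n with
  | zero =>
    intro x k hk _ h
    simp only [Subgroup.upperCentralSeries_zero, Subgroup.mem_bot] at h ⊢
    exact htf x k hk h
  | succ n ih =>
    intro x k hk hx h
    rw [Subgroup.mem_upperCentralSeries_succ_iff] at h hx ⊢
    intro y
    refine ih _ k hk (hx y) ?_
    have hc := mem_upperCentralSeries_succ_iff_mk.1 (hx y)
    have hky := h y
    set N := Subgroup.upperCentralSeries Γ n
    rw [← QuotientGroup.eq_one_iff] at hky ⊢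
    rw [Subgroup.mem_center_iff] at hc
    -- Modulo Z_n the commutator [x, y] is central, so [x^j, y] = [x, y]^j. Torsion in one factor of
    -- the series is thereby pushed down to the previous factor.
    have key : ∀ j : ℕ, (x : Γ ⧸ N) ^ j * (y : Γ ⧸ N) =
        ((⁅x, y⁆ : Γ) : Γ ⧸ N) ^ j * (y : Γ ⧸ N) * (x : Γ ⧸ N) ^ j := by
      intro j
      induction j with
      | zero => simp
      | succ j ihj =>
        have h1 : (x : Γ ⧸ N) * y = ((⁅x, y⁆ : Γ) : Γ ⧸ N) * y * x := by
          rw [← QuotientGroup.mk_mul, ← QuotientGroup.mk_mul, ← QuotientGroup.mk_mul]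
          congr 1
          rw [commutatorElement_def]; group
        rw [pow_succ, mul_assoc, h1, mul_assoc, ← mul_assoc (_ ^ j), hc (_ ^ j), mul_assoc,
          ← mul_assoc (_ ^ j), ihj, pow_succ']
        simp only [mul_assoc]
        rfl
    have h2 := key k
    have h3 : (x : Γ ⧸ N) ^ k * (y : Γ ⧸ N) * ((x : Γ ⧸ N) ^ k)⁻¹ * (y : Γ ⧸ N)⁻¹ = 1 := by
      simpa [commutatorElement_def] using hky
    rw [h2] at h3
    rw [QuotientGroup.mk_pow]
    simpa using h3

/-- A torsion-free hypercentral group has a two-sided invariant total order. -/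
theorem exists_isOrderCone (hΓ : IsHypercentral Γ)
    (htf : ∀ (a : Γ) (n : ℕ), n ≠ 0 → a ^ n = 1 → a = 1) : ∃ P : Set Γ, IsOrderCone P := by
  classical
  have hex : ∀ n, ∃ P : Set (Subgroup.center (Γ ⧸ Subgroup.upperCentralSeries Γ n)), IsOrderCone P := by
    intro n
    refine exists_isOrderCone_of_comm 
      (fun a b => Subtype.ext (Subgroup.mem_center_iff.1 b.2 a)) ?_
    rintro ⟨a, ha⟩ k hk hak
    obtain ⟨x, rfl⟩ := QuotientGroup.mk_surjective a
    have h1 : x ^ k ∈ Subgroup.upperCentralSeries Γ n := by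
      rw [← QuotientGroup.eq_one_iff, QuotientGroup.mk_pow]
      exact congrArg Subtype.val hak
    have h2 := mem_upperCentralSeries_of_pow_mem htf n x k hk
      (mem_upperCentralSeries_succ_iff_mk.2 ha) h1
    exact Subtype.ext ((QuotientGroup.eq_one_iff x).2 h2)
  choose Q hQ using hex
  -- The sign of x is read in the factor Z_{n+1}/Z_n where x is first nontrivial. Centrality of this
  -- factor makes the order conjugation invariant, and in a product the higher layer dominates.
  let P : Set Γ := {x | ∃ n, ∃ h : (x : Γ ⧸ Subgroup.upperCentralSeries Γ n) ∈ Subgroup.center (Γ ⧸ Subgroup.upperCentralSeries Γ n),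
    (⟨x, h⟩ : Subgroup.center (Γ ⧸ Subgroup.upperCentralSeries Γ n)) ∈ Q n}
  have habs : ∀ {n} {x y : Γ} (h : (x : Γ ⧸ Subgroup.upperCentralSeries Γ n) ∈ Subgroup.center (Γ ⧸ Subgroup.upperCentralSeries Γ n)),
      (⟨x, h⟩ : Subgroup.center (Γ ⧸ Subgroup.upperCentralSeries Γ n)) ∈ Q n → (y : Γ ⧸ Subgroup.upperCentralSeries Γ n) = x → y ∈ P := by
    intro n x y h hq e
    refine ⟨n, e ▸ h, ?_⟩
    convert hq
  refine ⟨P, ?_, ?_, ?_, ?_⟩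
  · rintro ⟨n, h, hq⟩
    exact (hQ n).one_notMem hq
  · rintro x ⟨n, hx, hxq⟩ y ⟨m, hy, hyq⟩
    rcases lt_trichotomy n m with h | rfl | h
    · refine habs hy hyq ?_
      have : x ∈ Subgroup.upperCentralSeries Γ m := Subgroup.upperCentralSeries_mono Γ (Nat.succ_le_of_lt h)
        (mem_upperCentralSeries_succ_iff_mk.2 hx)
      rw [QuotientGroup.mk_mul, (QuotientGroup.eq_one_iff x).2 this, one_mul]
    · exact habs (Subgroup.mul_mem _ hx hy) ((hQ n).mul_mem _ hxq _ hyq) rfl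
    · refine habs hx hxq ?_
      have : y ∈ Subgroup.upperCentralSeries Γ n := Subgroup.upperCentralSeries_mono Γ (Nat.succ_le_of_lt h)
        (mem_upperCentralSeries_succ_iff_mk.2 hy)
      rw [QuotientGroup.mk_mul, (QuotientGroup.eq_one_iff y).2 this, mul_one]
  · rintro g x ⟨n, hx, hxq⟩
    refine habs hx hxq ?_
    rw [QuotientGroup.mk_mul, QuotientGroup.mk_mul, Subgroup.mem_center_iff.1 hx,
      QuotientGroup.mk_inv, mul_inv_cancel_right]
  · intro x
    by_cases hx1 : x = 1
    · exact .inr (.inl hx1)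
    have hx := hΓ.exists_mem x
    obtain ⟨n, hn⟩ : ∃ n, Nat.find hx = n + 1 := by
      refine Nat.exists_eq_succ_of_ne_zero fun h => hx1 ?_
      have := Nat.find_spec hx
      rw [h] at this
      simpa using this
    have hmem : x ∈ Subgroup.upperCentralSeries Γ (n + 1) := hn ▸ Nat.find_spec hx
    have hnot : x ∉ Subgroup.upperCentralSeries Γ n := Nat.find_min hx (by omega)
    have hc := mem_upperCentralSeries_succ_iff_mk.1 hmem
    rcases (hQ n).total ⟨x, hc⟩ with h | h | h
    · exact .inl ⟨n, hc, h⟩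
    · exact absurd ((QuotientGroup.eq_one_iff x).1 (congrArg Subtype.val h)) hnot
    · exact .inr (.inr ⟨n, Subgroup.inv_mem _ hc, h⟩)

end Order

/-! ### From the action on torsion elements to hypercentral units. -/

section Sufficiency
variable {G : Type*} [Group G]

/-- Every element of `G` fixes or inverts each element of finite order. -/
def FixesOrInvertsTorsion (G : Type*) [Group G] : Prop :=
  ∀ g t : G, IsOfFinOrder t → g⁻¹ * t * g = t ∨ g⁻¹ * t * g = t⁻¹

lemma IsTorsionSubgroup.normal {T : Subgroup G} (hT : IsTorsionSubgroup T) : T.Normal where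
  conj_mem t ht g := by
    rw [hT] at ht ⊢
    obtain ⟨n, hn, h⟩ := isOfFinOrder_iff_pow_eq_one.1 ht
    exact isOfFinOrder_iff_pow_eq_one.2 ⟨n, hn, by rw [conj_pow, h]; simp⟩

lemma mul_single_comm_of_conj_invariant {r : ℤ[G]} {g : G}
    (h : ∀ t, r.coeff (g⁻¹ * t * g) = r.coeff t) (n : ℤ) :
    r * MonoidAlgebra.single g n = MonoidAlgebra.single g n * r := by
  ext x
  rw [MonoidAlgebra.coeff_mul_single_apply, MonoidAlgebra.coeff_single_mul_apply, ← h (x * g⁻¹), mul_comm]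
  congr 2
  group

lemma comm_of_forall_single {r : ℤ[G]}
    (h : ∀ g n, r * MonoidAlgebra.single g n = MonoidAlgebra.single g n * r) (b : ℤ[G]) :
    r * b = b * r := by
  induction b using MonoidAlgebra.induction_linear with
  | zero => simp
  | add b b' h h' => rw [mul_add, add_mul, h, h']
  | single g n => exact h g n

variable {Γ : Type*} [Group Γ] {φ : G →* Γ}

/-- Self-adjoint elements supported on torsion elements are central. -/
lemma Homog.comm_of_conj_eq (hP : FixesOrInvertsTorsion G)
    (hφ : ∀ t, φ t = 1 → IsOfFinOrder t) {r : ℤ[G]} (hr : Homog φ 1 r) (hs : conj r = r)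
    (b : ℤ[G]) : r * b = b * r := by
  refine comm_of_forall_single (fun g n => mul_single_comm_of_conj_invariant (fun t => ?_) n) b
  by_cases ht : φ t = 1
  · rcases hP g t (hφ t ht) with h | h
    · rw [h]
    · rw [h, ← coeff_conj, hs]
  · have h1 : r.coeff t = 0 := by
      by_contra h; exact ht (hr t h)
    have h2 : r.coeff (g⁻¹ * t * g) = 0 := by
      by_contra h
      have := hr _ h
      simp only [map_mul, map_inv] at this
      apply ht
      have h3 : φ t = φ g * ((φ g)⁻¹ * φ t * φ g) * (φ g)⁻¹ := by group
      rw [h3, this]; simp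
    rw [h1, h2]

lemma Homog.mul_conj_comm (hP : FixesOrInvertsTorsion G)
    (hφ : ∀ t, φ t = 1 → IsOfFinOrder t) {x : Γ} {a : ℤ[G]} (ha : Homog φ x a) (b : ℤ[G]) :
    a * conj a * b = b * (a * conj a) :=
  Homog.comm_of_conj_eq hP hφ (by simpa using ha.mul ha.map_conj) (by simp) b

lemma Homog.conj_mul_comm (hP : FixesOrInvertsTorsion G)
    (hφ : ∀ t, φ t = 1 → IsOfFinOrder t) {x : Γ} {a : ℤ[G]} (ha : Homog φ x a) (b : ℤ[G]) :
    conj a * a * b = b * (conj a * a) :=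
  Homog.comm_of_conj_eq hP hφ (by simpa using ha.map_conj.mul ha) (by simp) b

/-- The element a*a is central, so a(a*a)a* = a*(aa)a* = 0. The left side is bb* for b = aa*, and
positivity applies twice. -/
lemma homogReduced (hP : FixesOrInvertsTorsion G) (hφ : ∀ t, φ t = 1 → IsOfFinOrder t) :
    HomogReduced φ := by
  intro x a ha haa
  apply eq_zero_of_mul_conj
  apply eq_zero_of_mul_conj
  have h1 := ha.conj_mul_comm hP hφ a
  calc a * conj a * conj (a * conj a) = a * (conj a * a) * conj a := by
        simp only [conj_mul, conj_conj, mul_assoc]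
    _ = conj a * (a * a) * conj a := by rw [← h1]; simp only [mul_assoc]
    _ = 0 := by rw [haa]; simp

lemma Homog.eq {x y : Γ} {a : ℤ[G]} (hx : Homog φ x a) (hy : Homog φ y a) (h : a ≠ 0) :
    x = y := by
  obtain ⟨g, hg⟩ : ∃ g, a.coeff g ≠ 0 := by
    by_contra! h0
    exact h (by ext g; simp [h0])
  rw [← hx g hg, hy g hg]

/-- The embedding of `G` into the group of units of augmentation one. -/
noncomputable def toUnitsOne (G : Type*) [Group G] : G →* unitsOne G :=
  ((Units.map (MonoidAlgebra.of ℤ G)).comp (toUnits (G := G)).toMonoidHom).codRestrict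
    (unitsOne G) (by intro g; rw [mem_unitsOne]; simp [augmentation_single])

lemma coe_toUnitsOne (g : G) :
    ((toUnitsOne G g : (ℤ[G])ˣ) : ℤ[G]) = MonoidAlgebra.single g 1 := rfl

lemma unitsOne_ext {u v : unitsOne G} (h : ((u : (ℤ[G])ˣ) : ℤ[G]) = ((v : (ℤ[G])ˣ) : ℤ[G])) :
    u = v := Subtype.ext (Units.ext h)

lemma toUnitsOne_mem_center {s : G} (hs : s ∈ Subgroup.center G) :
    toUnitsOne G s ∈ Subgroup.center (unitsOne G) := by
  rw [Subgroup.mem_center_iff]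
  intro w
  apply unitsOne_ext
  refine (comm_of_forall_single (fun g n => ?_) _).symm
  rw [coe_toUnitsOne, MonoidAlgebra.single_mul_single, MonoidAlgebra.single_mul_single,
    Subgroup.mem_center_iff.1 hs g, mul_comm]

lemma toUnitsOne_injective : Function.Injective (toUnitsOne G) := by
  intro g h hgh
  have := congrArg (fun u : unitsOne G => ((u : (ℤ[G])ˣ) : ℤ[G]).coeff g) hgh
  simp only [coe_toUnitsOne] at this
  by_contra hne
  simp [Finsupp.single_eq_of_ne hne] at this

lemma eq_toUnitsOne_of_mul_conj {v : unitsOne G}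
    (h : ((v : (ℤ[G])ˣ) : ℤ[G]) * conj ((v : (ℤ[G])ˣ) : ℤ[G]) = 1) :
    ∃ g, v = toUnitsOne G g := by
  obtain ⟨g, n, hg⟩ := exists_eq_single_of_mul_conj h
  have h1 := (mem_unitsOne G v).1 v.2
  rw [hg, augmentation_single] at h1
  refine ⟨g, unitsOne_ext ?_⟩
  rw [hg, h1, coe_toUnitsOne]

lemma IsHypercentral.of_surjective {H : Type*} [Group H] (hG : IsHypercentral G) {f : G →* H}
    (hf : Function.Surjective f) : IsHypercentral H := by
  refine Set.eq_univ_of_forall fun y => ?_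
  obtain ⟨x, rfl⟩ := hf y
  obtain ⟨n, hn⟩ := hG.exists_mem x
  exact mem_hypercenter_iff.2 ⟨n, Subgroup.upperCentralSeries.map hf n ⟨x, hn, rfl⟩⟩

/-- Involutions are central when torsion elements are fixed or inverted. -/
lemma mem_center_of_sq_eq_one (hP : FixesOrInvertsTorsion G) {k : G} (hk : k ^ 2 = 1) :
    k ∈ Subgroup.center G := by
  rw [Subgroup.mem_center_iff]
  intro g
  have hinv : k⁻¹ = k := by
    rw [inv_eq_iff_mul_eq_one, ← sq, hk]
  have := hP g k (isOfFinOrder_iff_pow_eq_one.2 ⟨2, by norm_num, hk⟩)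
  rw [hinv, or_self] at this
  rw [← eq_inv_mul_iff_mul_eq, ← mul_assoc, this]

/-- The commutator is trivial unless s and t invert each other. In that case it equals t² = s⁻²,
which s both centralizes and inverts, so it has square 1 and is central. -/
lemma commutator_mem_center (hP : FixesOrInvertsTorsion G) {s t : G} (hs : IsOfFinOrder s)
    (ht : IsOfFinOrder t) : ⁅t, s⁆ ∈ Subgroup.center G := by
  apply mem_center_of_sq_eq_one hP
  rw [commutatorElement_def]
  rcases hP s⁻¹ t ht with h1 | h1
  · rw [inv_inv] at h1
    have : t * s * t⁻¹ * s⁻¹ = t * (s * t * s⁻¹)⁻¹ := by group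
    rw [this, h1]; simp
  · rcases hP t⁻¹ s hs with h2 | h2
    · rw [inv_inv] at h2
      rw [h2]; simp
    · rw [inv_inv] at h1 h2
      have h3 : t * s * t⁻¹ * s⁻¹ = t * (s * t * s⁻¹)⁻¹ := by group
      have h4 : t * s * t⁻¹ * s⁻¹ = s⁻¹ * s⁻¹ := by rw [h2]
      have h5 : t * t = s⁻¹ * s⁻¹ := by rw [← h4, h3, h1, inv_inv]
      have h6 : t * t = t⁻¹ * t⁻¹ := by
        calc t * t = s * (t * t) * s⁻¹ := by rw [h5]; group
          _ = (s * t * s⁻¹) * (s * t * s⁻¹) := by group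
          _ = t⁻¹ * t⁻¹ := by rw [h1]
      rw [h4, ← h5, sq]
      nth_rewrite 1 [h6]
      group

lemma homog_toUnitsOne (g : G) : Homog φ (φ g) ((toUnitsOne G g : (ℤ[G])ˣ) : ℤ[G]) :=
  homog_single g 1

lemma Homog.coe_inv {u : unitsOne G} {x : Γ} (hu : Homog φ x ((u : (ℤ[G])ˣ) : ℤ[G]))
    (hex : ∀ u : unitsOne G, ∃ x, Homog φ x ((u : (ℤ[G])ˣ) : ℤ[G])) :
    Homog φ x⁻¹ (((u⁻¹ : unitsOne G) : (ℤ[G])ˣ) : ℤ[G]) := by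
  obtain ⟨y, hy⟩ := hex u⁻¹
  have h1 : Homog φ (x * y) (1 : ℤ[G]) := by
    have := hu.mul hy
    rwa [← Units.val_mul, ← Subgroup.coe_mul, mul_inv_cancel] at this
  rwa [inv_eq_of_mul_eq_one_right (h1.eq homog_one one_ne_zero)]

/-- If all units of augmentation one are homogeneous, their commutators are group elements. -/
lemma exists_commutator_eq_toUnitsOne (hP : FixesOrInvertsTorsion G)
    (hφ : ∀ t, φ t = 1 → IsOfFinOrder t)
    (hex : ∀ u : unitsOne G, ∃ x, Homog φ x ((u : (ℤ[G])ˣ) : ℤ[G])) (u w : unitsOne G) :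
    ∃ g, ⁅u, w⁆ = toUnitsOne G g := by
  apply eq_toUnitsOne_of_mul_conj
  have hc : ∀ (v : unitsOne G) (b : ℤ[G]), ((v : (ℤ[G])ˣ) : ℤ[G]) * conj ((v : (ℤ[G])ˣ) : ℤ[G]) * b =
      b * (((v : (ℤ[G])ˣ) : ℤ[G]) * conj ((v : (ℤ[G])ˣ) : ℤ[G])) := fun v b =>
    (hex v).choose_spec.mul_conj_comm hP hφ b
  have hinv : ∀ v : unitsOne G, ((v : (ℤ[G])ˣ) : ℤ[G]) * (((v⁻¹ : unitsOne G) : (ℤ[G])ˣ) : ℤ[G]) = 1 := by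
    intro v
    rw [← Units.val_mul, ← Subgroup.coe_mul, mul_inv_cancel]; rfl
  have hu := hinv u
  have hw := hinv w
  have hcw' := hc w⁻¹
  have hcu' := hc u⁻¹
  rw [commutatorElement_def]
  simp only [Subgroup.coe_mul, Units.val_mul]
  set a : ℤ[G] := ((u : (ℤ[G])ˣ) : ℤ[G])
  set b : ℤ[G] := ((w : (ℤ[G])ˣ) : ℤ[G])
  set a' : ℤ[G] := (((u⁻¹ : unitsOne G) : (ℤ[G])ˣ) : ℤ[G])
  set b' : ℤ[G] := (((w⁻¹ : unitsOne G) : (ℤ[G])ˣ) : ℤ[G])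
  have hu2 : conj a' * conj a = 1 := by rw [← conj_mul, hu, conj_one]
  have hw2 : conj b' * conj b = 1 := by rw [← conj_mul, hw, conj_one]
  -- The central elements b'b'* and a'a'* are moved past their neighbours until each factor meets
  -- its inverse.
  calc a * b * a' * b' * conj (a * b * a' * b')
      = a * b * (a' * (b' * conj b' * conj a')) * (conj b * conj a) := by
        simp only [conj_mul, mul_assoc]
    _ = a * b * (a' * conj a' * (b' * conj b' * conj b)) * conj a := by
        rw [hcw' (conj a')]; simp only [mul_assoc]
    _ = a * (b * b') * (conj b' * conj b) * (a' * conj a') * conj a := by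
        rw [hcu' (b' * conj b' * conj b)]; simp only [mul_assoc]
    _ = a * a' * (conj a' * conj a) := by rw [hw, hw2]; simp only [mul_assoc, one_mul]
    _ = 1 := by rw [hu, hu2, one_mul]

end Sufficiency

section Sufficiency
variable {G : Type*} [Group G]

lemma mapDomain_comm {Γ Δ : Type*} [Group Γ] [Group Δ] {φ : G →* Γ} {ψ : G →* Δ} {x : Γ} {t : G}
    (h : ∀ g, φ g = x → ψ g * ψ t = ψ t * ψ g) {a : ℤ[G]} (ha : Homog φ x a) :
    MonoidAlgebra.mapDomainRingHom ℤ ψ a * MonoidAlgebra.single (ψ t) 1 =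
      MonoidAlgebra.single (ψ t) 1 * MonoidAlgebra.mapDomainRingHom ℤ ψ a := by
  have hsum : a = ∑ g ∈ a.coeff.support, MonoidAlgebra.single g (a.coeff g) := by
    conv_lhs => rw [← MonoidAlgebra.sum_coeff_single a]
    rfl
  rw [hsum, map_sum, Finset.sum_mul, Finset.mul_sum]
  refine Finset.sum_congr rfl fun g hg => ?_
  simp [MonoidAlgebra.single_mul_single, h g (ha g (Finsupp.mem_support_iff.1 hg))]

variable {T : Subgroup G} [T.Normal]

local notation "π" => QuotientGroup.mk' T

/-- Commutators of torsion elements with units supported on torsion elements are central. -/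
lemma exists_commutator_eq_central (hP : FixesOrInvertsTorsion G) (hT : IsTorsionSubgroup T)
    (hex : ∀ u : unitsOne G, ∃ x, Homog π x ((u : (ℤ[G])ˣ) : ℤ[G])) {t : G} (ht : t ∈ T)
    {a : unitsOne G} (ha : Homog π 1 ((a : (ℤ[G])ˣ) : ℤ[G])) :
    ∃ s ∈ Subgroup.center G, ⁅toUnitsOne G t, a⁆ = toUnitsOne G s := by
  have hφ : ∀ t, π t = 1 → IsOfFinOrder t := fun t h => (hT t).1 ((QuotientGroup.eq_one_iff t).1 h)
  obtain ⟨s, hs⟩ := exists_commutator_eq_toUnitsOne hP hφ hex (toUnitsOne G t) a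
  refine ⟨s, ?_, hs⟩
  have h1 : toUnitsOne G t * a = toUnitsOne G s * a * toUnitsOne G t := by
    rw [← hs, commutatorElement_def]; group
  -- Torsion elements commute modulo the centre of G, so t commutes with the image of a there, and s
  -- must become trivial.
  set ψ := QuotientGroup.mk' (Subgroup.center G)
  have h2 := congrArg (fun u : unitsOne G =>
    MonoidAlgebra.mapDomainRingHom ℤ ψ ((u : (ℤ[G])ˣ) : ℤ[G])) h1
  simp only [Subgroup.coe_mul, Units.val_mul, map_mul, coe_toUnitsOne] at h2
  rw [mul_assoc] at h2
  have h3 := mapDomain_comm (ψ := ψ) (t := t) (fun g hg => ?_) ha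
  · simp only [MonoidAlgebra.mapDomainRingHom_apply, MonoidAlgebra.mapDomain_single] at h2 h3
    rw [h3, ← mul_assoc] at h2
    have hunit : IsUnit (MonoidAlgebra.mapDomain ψ ((a : (ℤ[G])ˣ) : ℤ[G])) :=
      (a : (ℤ[G])ˣ).isUnit.map (MonoidAlgebra.mapDomainRingHom ℤ ψ)
    have h4 := hunit.mul_right_cancel h2
    rw [MonoidAlgebra.single_mul_single, MonoidAlgebra.single_inj] at h4
    simp only [one_ne_zero, and_true, mul_one, and_self, or_false, right_eq_mul] at h4
    exact (QuotientGroup.eq_one_iff s).1 h4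
  · rw [← map_mul, ← map_mul]
    refine QuotientGroup.eq.2 ?_
    have hc := commutator_mem_center hP (hφ g hg).inv ((hT t).1 ht).inv
    convert hc using 1
    rw [commutatorElement_def]; group

/-- Writing w = ag with a supported on T, [t, ag] = s · a[t, g]a⁻¹ with s central. The factor s
costs one extra level, whence `n + 1`. -/
lemma toUnitsOne_mem_upperCentralSeries_of_mem_torsion (hP : FixesOrInvertsTorsion G)
    (hT : IsTorsionSubgroup T)
    (hex : ∀ u : unitsOne G, ∃ x, Homog π x ((u : (ℤ[G])ˣ) : ℤ[G]))
    (hdec : ∀ u : unitsOne G, ∃ (a : unitsOne G) (g : G),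
      Homog π 1 ((a : (ℤ[G])ˣ) : ℤ[G]) ∧ u = a * toUnitsOne G g) (n : ℕ) :
    ∀ t ∈ T, t ∈ Subgroup.upperCentralSeries G n →
      toUnitsOne G t ∈ Subgroup.upperCentralSeries (unitsOne G) (n + 1) := by
  induction n with
  | zero =>
    intro t _ h
    rw [Subgroup.upperCentralSeries_zero, Subgroup.mem_bot] at h
    rw [h, map_one]; exact one_mem _
  | succ n ih =>
    intro t ht h
    rw [Subgroup.mem_upperCentralSeries_succ_iff] at h ⊢
    intro w
    obtain ⟨a, g, ha, rfl⟩ := hdec w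
    obtain ⟨s, hs, hsa⟩ := exists_commutator_eq_central hP hT hex ht ha
    have h1 : ⁅toUnitsOne G t, a * toUnitsOne G g⁆ =
        toUnitsOne G s * (a * toUnitsOne G ⁅t, g⁆ * a⁻¹) := by
      rw [← hsa, map_commutatorElement]
      simp only [commutatorElement_def]; group
    rw [h1]
    refine mul_mem ?_ (Subgroup.Normal.conj_mem inferInstance _ (ih _ ?_ (h g)) _)
    · refine Subgroup.upperCentralSeries_mono (unitsOne G) (show 1 ≤ n + 1 by omega) ?_
      rw [Subgroup.upperCentralSeries_one]
      exact toUnitsOne_mem_center hs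
    · rw [commutatorElement_def, mul_assoc, mul_assoc]
      refine mul_mem ht ?_
      rw [← mul_assoc]
      exact Subgroup.Normal.conj_mem inferInstance _ (inv_mem ht) _

/-- Since [t, g] is 1 or t², T lies in Z_{m+1}(G), hence in Z_{m+2} of the units. Commutators with a
unit supported on T land in T, so such units lie in Z_{m+3}. Modulo these the units come from G, and
Z_n(G) lands in Z_{m+3+n}. -/
theorem isHypercentral_unitsOne (hG : IsHypercentral G) (hP : FixesOrInvertsTorsion G)
    (hT : IsTorsionSubgroup T) {m : ℕ}
    (hm : ∀ t ∈ T, t ^ 2 ∈ Subgroup.upperCentralSeries G m) : IsHypercentral (unitsOne G) := by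
  have hφ : ∀ t, π t = 1 → IsOfFinOrder t := fun t h => (hT t).1 ((QuotientGroup.eq_one_iff t).1 h)
  obtain ⟨P, hcone⟩ : ∃ P : Set (G ⧸ T), IsOrderCone P := by
    refine exists_isOrderCone (hG.of_surjective (QuotientGroup.mk'_surjective T)) ?_
    intro a n hn ha
    obtain ⟨x, rfl⟩ := QuotientGroup.mk_surjective a
    rw [← QuotientGroup.mk_pow, QuotientGroup.eq_one_iff, hT] at ha
    rw [QuotientGroup.eq_one_iff, hT]
    exact (isOfFinOrder_pow.1 ha).resolve_right hn
  have hex : ∀ u : unitsOne G, ∃ x, Homog π x ((u : (ℤ[G])ˣ) : ℤ[G]) := fun u =>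
    exists_homog_of_mul_eq_one (homogReduced hP hφ) hcone (Units.mul_inv (u : (ℤ[G])ˣ))
  have hdec : ∀ u : unitsOne G, ∃ (a : unitsOne G) (g : G),
      Homog π 1 ((a : (ℤ[G])ˣ) : ℤ[G]) ∧ u = a * toUnitsOne G g := by
    intro u
    obtain ⟨x, hx⟩ := hex u
    obtain ⟨g, rfl⟩ := QuotientGroup.mk'_surjective T x
    refine ⟨u * toUnitsOne G g⁻¹, g, ?_, by simp⟩
    simpa using hx.mul (homog_toUnitsOne (φ := π) g⁻¹)
  have hTZ : ∀ t ∈ T, toUnitsOne G t ∈ Subgroup.upperCentralSeries (unitsOne G) (m + 2) := by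
    intro t ht
    refine toUnitsOne_mem_upperCentralSeries_of_mem_torsion hP hT hex hdec (m + 1) t ht ?_
    rw [Subgroup.mem_upperCentralSeries_succ_iff]
    intro g
    have h1 : ⁅t, g⁆ = t * (g⁻¹⁻¹ * t * g⁻¹)⁻¹ := by rw [commutatorElement_def]; group
    rcases hP g⁻¹ t ((hT t).1 ht) with h | h
    · rw [h1, h, mul_inv_cancel]; exact one_mem _
    · rw [h1, h, inv_inv, ← sq]; exact hm t ht
  have hA : ∀ a : unitsOne G, Homog π 1 ((a : (ℤ[G])ˣ) : ℤ[G]) →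
      a ∈ Subgroup.upperCentralSeries (unitsOne G) (m + 3) := by
    intro a ha
    rw [Subgroup.mem_upperCentralSeries_succ_iff]
    intro w
    obtain ⟨s, hs⟩ := exists_commutator_eq_toUnitsOne hP hφ hex a w
    rw [hs]
    refine hTZ s ((QuotientGroup.eq_one_iff s).1 ?_)
    obtain ⟨x, hx⟩ := hex w
    have h1 : Homog π 1 (((a * w * a⁻¹ * w⁻¹ : unitsOne G) : (ℤ[G])ˣ) : ℤ[G]) := by
      simpa using ((ha.mul hx).mul (ha.coe_inv hex)).mul (hx.coe_inv hex)
    rw [← commutatorElement_def, hs] at h1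
    exact (homog_toUnitsOne s).eq h1 (Units.ne_zero _)
  have hGZ : ∀ n, ∀ g ∈ Subgroup.upperCentralSeries G n,
      toUnitsOne G g ∈ Subgroup.upperCentralSeries (unitsOne G) (m + 3 + n) := by
    intro n
    induction n with
    | zero =>
      intro g hg
      rw [Subgroup.upperCentralSeries_zero, Subgroup.mem_bot] at hg
      rw [hg, map_one]; exact one_mem _
    | succ n ih =>
      intro g hg
      rw [Subgroup.mem_upperCentralSeries_succ_iff] at hg
      rw [← add_assoc, Subgroup.mem_upperCentralSeries_succ_iff]
      intro w
      obtain ⟨a, h, ha, rfl⟩ := hdec w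
      have haZ := Subgroup.upperCentralSeries_mono (unitsOne G)
        (show m + 3 ≤ m + 3 + n by omega) (hA a ha)
      have h1 : ⁅toUnitsOne G g, a * toUnitsOne G h⁆ =
          (toUnitsOne G g * a * (toUnitsOne G g)⁻¹) * toUnitsOne G ⁅g, h⁆ * a⁻¹ := by
        rw [map_commutatorElement]
        simp only [commutatorElement_def]; group
      rw [h1]
      exact mul_mem (mul_mem (Subgroup.Normal.conj_mem inferInstance _ haZ _) (ih _ (hg h)))
        (inv_mem haZ)
  refine Set.eq_univ_of_forall fun w => ?_
  obtain ⟨a, g, ha, rfl⟩ := hdec w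
  obtain ⟨n, hn⟩ := hG.exists_mem g
  refine mem_hypercenter_iff.2 ⟨m + 3 + n, mul_mem ?_ (hGZ n g hn)⟩
  exact Subgroup.upperCentralSeries_mono (unitsOne G) (show m + 3 ≤ m + 3 + n by omega) (hA a ha)

end Sufficiency

/-! ### Torsion subgroups whose elements are fixed or inverted. -/

section TorsionStructure
variable {G : Type*} [Group G] {T : Subgroup G}

lemma quaternionGroup_two_conj (k x : QuaternionGroup 2) :
    k⁻¹ * x * k = x ∨ k⁻¹ * x * k = x⁻¹ := by
  revert k x; decide

lemma quaternionGroup_two_pow_four (x : QuaternionGroup 2) : x ^ 4 = 1 := by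
  revert x; decide

lemma fixesOrInvertsTorsion_of_le_center (hT : IsTorsionSubgroup T)
    (h : T ≤ Subgroup.center G) : FixesOrInvertsTorsion G := fun g t ht => by
  left
  rw [mul_assoc, ← Subgroup.mem_center_iff.1 (h ((hT t).2 ht)), inv_mul_cancel_left]

lemma fixesOrInvertsTorsion_of_signs (hT : IsTorsionSubgroup T)
    (h : IsAbelianTwoGroupActedOnBySigns T) : FixesOrInvertsTorsion G := fun g t ht => by
  obtain ⟨-, -, δ, hδ, h⟩ := h
  rw [h g t ((hT t).2 ht)]
  rcases hδ g with e | e <;> simp [e]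

lemma exists_eq_mul_of_isQuaternionTimesElementary {K E : Subgroup G}
    (hE : E ≤ Subgroup.center G) {t : G} (ht : t ∈ K ⊔ E) : ∃ k ∈ K, ∃ e ∈ E, t = k * e := by
  have : E.Normal := ⟨fun n hn g => by
    rwa [Subgroup.mem_center_iff.1 (hE hn), mul_inv_cancel_right]⟩
  rw [← SetLike.mem_coe, Subgroup.mul_normal, Set.mem_mul] at ht
  obtain ⟨k, hk, e, he, rfl⟩ := ht
  exact ⟨k, hk, e, he, rfl⟩

lemma fixesOrInvertsTorsion_of_quaternion (hT : IsTorsionSubgroup T)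
    (h : IsQuaternionTimesElementary T) : FixesOrInvertsTorsion G := fun g t ht => by
  obtain ⟨K, E, ⟨f⟩, hE2, hE, -, rfl, hK⟩ := h
  obtain ⟨k, hk, e, he, rfl⟩ := exists_eq_mul_of_isQuaternionTimesElementary hE ((hT t).2 ht)
  obtain ⟨l, hl, h⟩ := hK g
  have hec := Subgroup.mem_center_iff.1 (hE he)
  have hinv : e⁻¹ = e := by rw [inv_eq_iff_mul_eq_one, ← sq, hE2 e he]
  have h1 : g⁻¹ * (k * e) * g = l⁻¹ * k * l * e := by
    rw [← h k hk, ← mul_assoc, mul_assoc _ e g, ← hec g]; simp only [mul_assoc]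
  have h2 : l⁻¹ * k * l = k ∨ l⁻¹ * k * l = k⁻¹ := by
    rcases quaternionGroup_two_conj (f ⟨l, hl⟩) (f ⟨k, hk⟩) with h2 | h2
    · rw [← map_inv, ← map_mul, ← map_mul] at h2
      exact .inl (congrArg Subtype.val (f.injective h2))
    · rw [← map_inv, ← map_mul, ← map_mul, ← map_inv] at h2
      exact .inr (congrArg Subtype.val (f.injective h2))
  rcases h2 with h2 | h2
  · left; rw [h1, h2]
  · right; rw [h1, h2, mul_inv_rev, hinv, hec]

/-- The bound `m` must not depend on t. In the central and quaternion cases squares are central. In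
the sign case a single g inverts all of T, and t² = [t, g⁻¹] lies in whichever term contains g. -/
lemma exists_sq_mem_upperCentralSeries (hG : IsHypercentral G) (hT : IsTorsionSubgroup T)
    (h : T ≤ Subgroup.center G ∨ IsAbelianTwoGroupActedOnBySigns T ∨
      IsQuaternionTimesElementary T) :
    FixesOrInvertsTorsion G ∧ ∃ m, ∀ t ∈ T, t ^ 2 ∈ Subgroup.upperCentralSeries G m := by
  by_cases hc : T ≤ Subgroup.center G
  · refine ⟨fixesOrInvertsTorsion_of_le_center hT hc, 1, fun t ht => ?_⟩
    rw [Subgroup.upperCentralSeries_one]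
    exact pow_mem (hc ht) 2
  rcases h.resolve_left hc with h | h
  · refine ⟨fixesOrInvertsTorsion_of_signs hT h, ?_⟩
    obtain ⟨-, -, δ, hδ, h⟩ := h
    obtain ⟨s, hs, hsc⟩ := SetLike.not_le_iff_exists.1 hc
    obtain ⟨g, hg⟩ : ∃ g, g * s ≠ s * g := by
      by_contra! hcon
      exact hsc (Subgroup.mem_center_iff.2 hcon)
    have hg1 : δ g = -1 := by
      refine (hδ g).resolve_left fun e => hg ?_
      have := h g s hs
      rw [e, zpow_one, mul_assoc] at this
      exact (inv_mul_eq_iff_eq_mul.1 this).symm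
    obtain ⟨n, hn⟩ := hG.exists_mem g
    refine ⟨n, fun t ht => ?_⟩
    have h1 := h g t ht
    rw [hg1, zpow_neg_one] at h1
    have h2 : t ^ 2 = t * g⁻¹ * t⁻¹ * g := by
      have : t = g⁻¹ * t⁻¹ * g := by simpa [mul_assoc] using (congrArg Inv.inv h1).symm
      calc t ^ 2 = t * (g⁻¹ * t⁻¹ * g) := by rw [← this, sq]
        _ = t * g⁻¹ * t⁻¹ * g := by group
    rw [h2]
    exact mul_mem (Subgroup.Normal.conj_mem inferInstance _ (inv_mem hn) _) hn
  · have hP := fixesOrInvertsTorsion_of_quaternion hT h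
    refine ⟨hP, 1, fun t ht => ?_⟩
    obtain ⟨K, E, ⟨f⟩, hE2, hE, -, rfl, hK⟩ := h
    rw [Subgroup.upperCentralSeries_one]
    apply mem_center_of_sq_eq_one hP
    obtain ⟨k, hk, e, he, rfl⟩ := exists_eq_mul_of_isQuaternionTimesElementary hE ht
    rw [← pow_mul, Commute.mul_pow (Subgroup.mem_center_iff.1 (hE he) k), pow_mul e, hE2 e he,
      one_pow, mul_one]
    have := quaternionGroup_two_pow_four (f ⟨k, hk⟩)
    rw [← map_pow, ← map_one f] at this
    exact congrArg Subtype.val (f.injective this)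

/-- The torsion elements form a subgroup if they are fixed or inverted by `G`. -/
def torsionSubgroup (hP : FixesOrInvertsTorsion G) : Subgroup G where
  carrier := {g | IsOfFinOrder g}
  one_mem' := IsOfFinOrder.one
  inv_mem' h := IsOfFinOrder.inv h
  mul_mem' {a b} ha hb := by
    rcases hP b⁻¹ a ha with h | h
    · rw [inv_inv] at h
      exact Commute.isOfFinOrder_mul (mul_inv_eq_iff_eq_mul.1 h).symm ha hb
    · rw [inv_inv] at h
      have h1 : (a * b) ^ 2 = b ^ 2 := by
        calc (a * b) ^ 2 = a * (b * a * b⁻¹) * b ^ 2 := by simp only [sq]; group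
          _ = b ^ 2 := by rw [h, mul_inv_cancel, one_mul]
      have h2 : IsOfFinOrder ((a * b) ^ 2) := h1 ▸ hb.pow
      exact (isOfFinOrder_pow.1 h2).resolve_right two_ne_zero

lemma isTorsionSubgroup_torsionSubgroup (hP : FixesOrInvertsTorsion G) :
    IsTorsionSubgroup (torsionSubgroup hP) := fun _ => Iff.rfl

/-- When g inverts t, [t, g⁻¹] = t², so each squaring descends one term of the series. -/
lemma pow_two_pow_eq_one_of_inverted {g : G} (n : ℕ) : ∀ t ∈ Subgroup.upperCentralSeries G n,
    g⁻¹ * t * g = t⁻¹ → t ^ 2 ^ n = 1 := by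
  induction n with
  | zero => intro t ht _; simpa using ht
  | succ n ih =>
    intro t ht h
    have h1 : ⁅t, g⁻¹⁆ = t ^ 2 := by
      have : t = g⁻¹ * t⁻¹ * g := by simpa [mul_assoc] using (congrArg Inv.inv h).symm
      calc ⁅t, g⁻¹⁆ = t * (g⁻¹ * t⁻¹ * g) := by rw [commutatorElement_def]; group
        _ = t ^ 2 := by rw [← this, sq]
    have h2 := ih (t ^ 2) (h1 ▸ Subgroup.mem_upperCentralSeries_succ_iff.1 ht g⁻¹) (by
      have : g⁻¹ * t ^ 2 * g = (g⁻¹ * t * g) ^ 2 := by simp only [sq]; group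
      rw [this, h, inv_pow])
    rwa [← pow_mul, ← pow_succ'] at h2

/-- If `g` inverts the torsion element `t ≠ t⁻¹` and centralizes `s`, then `t` inverts `s`. -/
lemma inverts_of_centralizes (hP : FixesOrInvertsTorsion G) {g s t : G} (hs : IsOfFinOrder s)
    (ht : IsOfFinOrder t) (hne : t⁻¹ ≠ t) (hgt : g⁻¹ * t * g = t⁻¹) (hgs : g⁻¹ * s * g = s) :
    t⁻¹⁻¹ * s * t⁻¹ = s⁻¹ := by
  have hst : IsOfFinOrder (s * t) := (torsionSubgroup hP).mul_mem hs ht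
  have h1 : g⁻¹ * (s * t) * g = s * t⁻¹ := by
    rw [← hgt]; nth_rewrite 2 [← hgs]; group
  -- g sends st to st⁻¹. This is not st, so it is (st)⁻¹ = t⁻¹s⁻¹, which says that tst⁻¹ = s⁻¹.
  rcases hP g _ hst with h | h
  · rw [h1] at h
    exact absurd (mul_left_cancel h) hne
  · rw [h1, mul_inv_rev] at h
    rw [mul_assoc, h]; group

/-- If g moves t but fixes s, then t inverts s; as T is abelian, s = s⁻¹ and g inverts s after all.
So the sign depends on g alone, and a g of sign -1 forces T to be a 2-group by hypercentrality. -/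
lemma isAbelianTwoGroupActedOnBySigns (hG : IsHypercentral G) (hP : FixesOrInvertsTorsion G)
    (hcomm : ∀ s ∈ torsionSubgroup hP, ∀ t ∈ torsionSubgroup hP, s * t = t * s)
    (hnc : ¬ torsionSubgroup hP ≤ Subgroup.center G) :
    IsAbelianTwoGroupActedOnBySigns (torsionSubgroup hP) := by
  classical
  have key : ∀ g : G, ∀ t ∈ torsionSubgroup hP, g⁻¹ * t * g ≠ t →
      ∀ s ∈ torsionSubgroup hP, g⁻¹ * s * g = s⁻¹ := by
    intro g t ht hgt s hs
    have h1 := (hP g t ht).resolve_left hgt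
    rcases hP g s hs with h | h
    · have h2 := inverts_of_centralizes hP hs ht (h1 ▸ hgt) h1 h
      rw [inv_inv, ← hcomm s hs t ht, mul_inv_cancel_right] at h2
      rw [h]; exact h2
    · exact h
  refine ⟨hcomm, ?_, fun g => if ∃ t ∈ torsionSubgroup hP, g⁻¹ * t * g ≠ t then -1 else 1, ?_, ?_⟩
  · obtain ⟨t, ht, htc⟩ := SetLike.not_le_iff_exists.1 hnc
    obtain ⟨g, hg⟩ : ∃ g, g⁻¹ * t * g ≠ t := by
      by_contra! hcon
      refine htc (Subgroup.mem_center_iff.2 fun g => ?_)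
      have := hcon g
      rw [mul_assoc] at this
      exact (inv_mul_eq_iff_eq_mul.1 this).symm
    rintro ⟨s, hs⟩
    obtain ⟨n, hn⟩ := hG.exists_mem s
    exact ⟨n, Subtype.ext (pow_two_pow_eq_one_of_inverted n s hn (key g t ht hg s hs))⟩
  · intro g
    dsimp only
    split_ifs <;> simp
  · intro g t ht
    dsimp only
    split_ifs with h
    · obtain ⟨s, hs, hgs⟩ := h
      rw [key g s hs hgs t ht, zpow_neg_one]
    · push Not at h
      rw [h t ht, zpow_one]

section Quaternion
variable {x y : G}

lemma inverts_of_not_commute (hP : FixesOrInvertsTorsion G) (hx : IsOfFinOrder x)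
    (hxy : x * y ≠ y * x) : y⁻¹ * x * y = x⁻¹ := by
  refine (hP y x hx).resolve_left fun h => hxy ?_
  rw [mul_assoc] at h
  exact inv_mul_eq_iff_eq_mul.1 h

/-- Noncommuting torsion elements invert each other, so x⁻¹y⁻¹xy equals both x⁻² and y². Then x
centralizes y² while inverting y, which gives y⁴ = 1. -/
lemma sq_eq_sq_of_not_commute (hP : FixesOrInvertsTorsion G) (hx : IsOfFinOrder x)
    (hy : IsOfFinOrder y) (hxy : x * y ≠ y * x) : x ^ 2 = y ^ 2 ∧ x ^ 4 = 1 := by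
  have h1 := inverts_of_not_commute hP hx hxy
  have h2 := inverts_of_not_commute hP hy hxy.symm
  have h3 : (x ^ 2)⁻¹ = y ^ 2 := by
    have e1 : x⁻¹ * (y⁻¹ * x * y) = (x ^ 2)⁻¹ := by rw [h1]; group
    have e2 : x⁻¹ * (y⁻¹ * x * y) = y ^ 2 := by
      have : x⁻¹ * y⁻¹ * x = y := by
        have : x⁻¹ * y⁻¹ * x = (x⁻¹ * y * x)⁻¹ := by group
        rw [this, h2, inv_inv]
      rw [← mul_assoc, ← mul_assoc, this, sq]
    rw [← e1, e2]
  have h4 : y ^ 2 = (y ^ 2)⁻¹ := by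
    calc y ^ 2 = x⁻¹ * (y ^ 2) * x := by rw [← h3]; group
      _ = (x⁻¹ * y * x) ^ 2 := by simp only [sq]; group
      _ = (y ^ 2)⁻¹ := by rw [h2, inv_pow]
  have h5 : x ^ 2 = y ^ 2 := by rw [h4, ← h3, inv_inv]
  refine ⟨h5, ?_⟩
  rw [show (4 : ℕ) = 2 + 2 from rfl, pow_add]
  nth_rewrite 1 [h5]
  rw [h4, ← h5, inv_mul_cancel]

/-- The homomorphism from the quaternion group determined by two generators. -/
def quaternionHom (h4 : x ^ 4 = 1) (h2 : x ^ 2 = y ^ 2) (hxy : y⁻¹ * x * y = x⁻¹) :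
    QuaternionGroup 2 →* G :=
  have hadd : ∀ i j : ZMod (2 * 2), x ^ (i + j).val = x ^ i.val * x ^ j.val := by
    intro i j
    rw [ZMod.val_add, ← pow_add, ← pow_eq_pow_mod _ h4]
  have hsub : ∀ i j : ZMod (2 * 2), x ^ (j - i).val = (x ^ i.val)⁻¹ * x ^ j.val := by
    intro i j
    rw [eq_inv_mul_iff_mul_eq, ← hadd]; congr 2; ring
  have hc : ∀ n : ℕ, x ^ n * y = y * (x ^ n)⁻¹ := by
    intro n
    rw [← inv_pow, ← hxy]
    have : (y⁻¹ * x * y) ^ n = y⁻¹ * x ^ n * y := by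
      simpa using conj_pow (a := y⁻¹) (b := x) (i := n)
    rw [this]; group
  MonoidHom.mk' (fun q => match q with
    | .a i => x ^ i.val
    | .xa i => y * x ^ i.val) (by
    rintro (i | i) (j | j)
    · rw [QuaternionGroup.a_mul_a]; exact hadd i j
    · rw [QuaternionGroup.a_mul_xa]
      simp only
      rw [hsub, ← mul_assoc, ← mul_assoc, hc]
    · rw [QuaternionGroup.xa_mul_a]
      simp only
      rw [hadd, mul_assoc]
    · rw [QuaternionGroup.xa_mul_xa]
      simp only
      rw [add_sub_assoc, hadd, hsub]
      have : x ^ (((2 : ℕ) : ZMod (2 * 2)).val) = x ^ 2 := rfl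
      rw [this, h2, mul_assoc y, ← mul_assoc _ y, hc, sq]
      simp only [mul_assoc])

end Quaternion
end TorsionStructure

section TorsionStructure
variable {G : Type*} [Group G] {x y : G}

lemma quaternionHom_a (h4 : x ^ 4 = 1) (h2 : x ^ 2 = y ^ 2) (hxy : y⁻¹ * x * y = x⁻¹)
    (i : ZMod (2 * 2)) : quaternionHom h4 h2 hxy (.a i) = x ^ i.val := rfl

lemma quaternionHom_xa (h4 : x ^ 4 = 1) (h2 : x ^ 2 = y ^ 2) (hxy : y⁻¹ * x * y = x⁻¹)
    (i : ZMod (2 * 2)) : quaternionHom h4 h2 hxy (.xa i) = y * x ^ i.val := rfl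

/-- A power of `x` commuting with `y` is `1` or `x ^ 2`. -/
lemma pow_eq_of_commute (h4 : x ^ 4 = 1) (hxy : x * y ≠ y * x) {i : ZMod (2 * 2)}
    (h : x ^ i.val * y = y * x ^ i.val) : x ^ i.val = 1 ∧ i = 0 ∨ x ^ i.val = x ^ 2 := by
  have hx3 : x ^ 3 = x⁻¹ := by rw [eq_inv_iff_mul_eq_one, ← pow_succ, h4]
  obtain rfl | rfl | rfl | rfl : i = 0 ∨ i = 1 ∨ i = 2 ∨ i = 3 := by
    clear h; revert i; decide
  · left; exact ⟨pow_zero x, rfl⟩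
  · exact absurd (by simpa using (show x ^ 1 * y = y * x ^ 1 from h)) hxy
  · right; rfl
  · exfalso
    have h' : x ^ 3 * y = y * x ^ 3 := h
    rw [hx3] at h'
    apply hxy
    rw [inv_mul_eq_iff_eq_mul, ← mul_assoc, eq_mul_inv_iff_mul_eq] at h'
    exact h'.symm

lemma sq_ne_one_of_inverted (hxy : x * y ≠ y * x) (h : y⁻¹ * x * y = x⁻¹) : x ^ 2 ≠ 1 := by
  intro h2
  have hinv : x⁻¹ = x := by rw [inv_eq_iff_mul_eq_one, ← sq, h2]
  rw [hinv, mul_assoc] at h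
  exact hxy (inv_mul_eq_iff_eq_mul.1 h)

lemma quaternionHom_injective (h4 : x ^ 4 = 1) (h2 : x ^ 2 = y ^ 2) (h : y⁻¹ * x * y = x⁻¹)
    (hxy : x * y ≠ y * x) : Function.Injective (quaternionHom h4 h2 h) := by
  rw [injective_iff_map_eq_one]
  rintro (i | i) hi
  · rw [quaternionHom_a] at hi
    rcases pow_eq_of_commute h4 hxy (i := i) (by rw [hi]; simp) with ⟨-, rfl⟩ | h'
    · rfl
    · exact absurd (h' ▸ hi) (sq_ne_one_of_inverted hxy h)
  · rw [quaternionHom_xa, mul_eq_one_iff_eq_inv] at hi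
    exact absurd (by rw [hi]; exact ((Commute.refl x).pow_right _).inv_right) hxy

/-- Every element acts on the quaternion subgroup as one of its members. -/
lemma exists_mem_range_quaternionHom_conj (hP : FixesOrInvertsTorsion G) (hx : IsOfFinOrder x)
    (hy : IsOfFinOrder y) (hxy : x * y ≠ y * x) (h4 : x ^ 4 = 1) (h2 : x ^ 2 = y ^ 2)
    (h : y⁻¹ * x * y = x⁻¹) (g : G) : ∃ k ∈ (quaternionHom h4 h2 h).range,
      ∀ z ∈ (quaternionHom h4 h2 h).range, g⁻¹ * z * g = k⁻¹ * z * k := by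
  have hxr : x ∈ (quaternionHom h4 h2 h).range := ⟨.a 1, by rw [quaternionHom_a]; exact pow_one x⟩
  have hyr : y ∈ (quaternionHom h4 h2 h).range := ⟨.xa 0, by rw [quaternionHom_xa]; simp⟩
  have h' := inverts_of_not_commute hP hy hxy.symm
  have hmain : ∃ k ∈ (quaternionHom h4 h2 h).range, g⁻¹ * x * g = k⁻¹ * x * k ∧
      g⁻¹ * y * g = k⁻¹ * y * k := by
    -- The four sign patterns on (x, y) are realized by 1, x, y and xy.
    rcases hP g x hx with e1 | e1 <;> rcases hP g y hy with e2 | e2 <;> rw [e1, e2]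
    · exact ⟨1, one_mem _, by simp, by simp⟩
    · exact ⟨x, hxr, by simp, h'.symm⟩
    · exact ⟨y, hyr, h.symm, by simp⟩
    · refine ⟨x * y, mul_mem hxr hyr, ?_, ?_⟩
      · rw [← h]; group
      · calc y⁻¹ = y⁻¹ * (y⁻¹) * y := by group
          _ = y⁻¹ * (x⁻¹ * y * x) * y := by rw [h']
          _ = _ := by group
  obtain ⟨k, hk, hkx, hky⟩ := hmain
  refine ⟨k, hk, ?_⟩
  have hpow : ∀ n : ℕ, g⁻¹ * x ^ n * g = k⁻¹ * x ^ n * k := by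
    intro n
    have e : ∀ a : G, a⁻¹ * x ^ n * a = (a⁻¹ * x * a) ^ n := fun a => by
      simpa using (conj_pow (a := a⁻¹) (b := x) (i := n)).symm
    rw [e, e, hkx]
  rintro _ ⟨i | i, rfl⟩
  · rw [quaternionHom_a, hpow]
  · rw [quaternionHom_xa]
    have e : ∀ a : G, a⁻¹ * (y * x ^ i.val) * a = (a⁻¹ * y * a) * (a⁻¹ * x ^ i.val * a) := fun a => by
      group
    rw [e, e, hky, hpow]

/-- In a subgroup of central involutions, the line through `z` has a complement. -/
lemma exists_complement {C : Subgroup G} (hC : C ≤ Subgroup.center G) (h2 : ∀ c ∈ C, c ^ 2 = 1)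
    {z : G} (hz : z ≠ 1) :
    ∃ E ≤ C, z ∉ E ∧ ∀ c ∈ C, c ∈ E ∨ c * z ∈ E := by
  -- Take E maximal avoiding z. If c ∉ E, then z ∈ E⟨c⟩, so z = ec with e ∈ E and cz = e.
  obtain ⟨E, -, hE⟩ := zorn_le_nonempty₀ {E : Subgroup G | E ≤ C ∧ z ∉ E} (by
    intro c hc hchain y hy
    refine ⟨sSup c, ⟨sSup_le fun E hE => (hc hE).1, fun hzs => ?_⟩, fun E hE => le_sSup hE⟩
    rw [Subgroup.mem_sSup_of_directedOn ⟨y, hy⟩ hchain.directedOn] at hzs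
    obtain ⟨E, hE, hzE⟩ := hzs
    exact (hc hE).2 hzE) ⊥ ⟨bot_le, by simpa using hz⟩
  refine ⟨E, hE.prop.1, hE.prop.2, fun c hc => ?_⟩
  by_contra! hcon
  have hle : E ≤ E ⊔ Subgroup.zpowers c := le_sup_left
  have : z ∈ E ⊔ Subgroup.zpowers c := by
    by_contra hz'
    have h1 := hE.2 ⟨sup_le hE.prop.1 (by simpa using hc), hz'⟩ hle
    exact hcon.1 (h1 (Subgroup.mem_sup_right (Subgroup.mem_zpowers c)))
  obtain ⟨e, he, d, hd, hed⟩ := exists_eq_mul_of_isQuaternionTimesElementary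
    (by simpa using hC hc) this
  obtain ⟨n, rfl⟩ := hd
  have hcc : c * c = 1 := by rw [← sq, h2 c hc]
  simp only at hed
  rcases Int.even_or_odd' n with ⟨k, rfl | rfl⟩
  · rw [zpow_mul, zpow_ofNat, h2 c hc, one_zpow, mul_one] at hed
    exact hE.prop.2 (hed ▸ he)
  · rw [zpow_add, zpow_mul, zpow_ofNat, h2 c hc, one_zpow, one_mul, zpow_one] at hed
    apply hcon.2
    rw [hed, ← mul_assoc, Subgroup.mem_center_iff.1 (hC (hE.prop.1 he)), mul_assoc, hcc, mul_one]
    exact he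

/-- With K = ⟨x, y⟩ and C the centralizer of K in T, T = KC because T acts on K by inner
automorphisms. Since K ∩ C = ⟨x²⟩, the factor E is a complement of ⟨x²⟩ in C. -/
lemma isQuaternionTimesElementary (hP : FixesOrInvertsTorsion G) (hx : IsOfFinOrder x)
    (hy : IsOfFinOrder y) (hxy : x * y ≠ y * x) :
    IsQuaternionTimesElementary (torsionSubgroup hP) := by
  obtain ⟨h2, h4⟩ := sq_eq_sq_of_not_commute hP hx hy hxy
  have h := inverts_of_not_commute hP hx hxy
  set f := quaternionHom h4 h2 h with hf
  have hinj : Function.Injective f := quaternionHom_injective h4 h2 h hxy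
  have hxr : x ∈ f.range := ⟨.a 1, by rw [hf, quaternionHom_a]; exact pow_one x⟩
  have hyr : y ∈ f.range := ⟨.xa 0, by rw [hf, quaternionHom_xa]; simp⟩
  have hfT : f.range ≤ torsionSubgroup hP := by
    rintro _ ⟨q, rfl⟩
    exact MonoidHom.isOfFinOrder f (isOfFinOrder_of_finite q)
  let C : Subgroup G := torsionSubgroup hP ⊓ Subgroup.centralizer {x, y}
  have hCmem : ∀ c, c ∈ C ↔ IsOfFinOrder c ∧ x * c = c * x ∧ y * c = c * y := by
    intro c
    simp only [C, Subgroup.mem_inf, Subgroup.mem_centralizer_iff, Set.mem_insert_iff,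
      Set.mem_singleton_iff, forall_eq_or_imp, forall_eq]
    rfl
  have hC2 : ∀ c ∈ C, c ^ 2 = 1 := by
    intro c hc
    obtain ⟨hc, hcx, hcy⟩ := (hCmem c).1 hc
    -- As cx and y do not commute, (cx)² = y² = x², whence c² = 1.
    have h1 : c * x * y ≠ y * (c * x) := by
      rw [← mul_assoc, hcy, mul_assoc, mul_assoc]
      exact fun e => hxy (mul_left_cancel e)
    have h3 := (sq_eq_sq_of_not_commute hP ((torsionSubgroup hP).mul_mem hc hx) hy h1).1
    rw [Commute.mul_pow hcx.symm, ← h2] at h3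
    simpa using h3
  have hCc : C ≤ Subgroup.center G := fun c hc => mem_center_of_sq_eq_one hP (hC2 c hc)
  obtain ⟨E, hEC, hzE, hE⟩ := exists_complement hCc hC2 (sq_ne_one_of_inverted hxy h)
  refine ⟨f.range, E, ⟨(MonoidHom.ofInjective hinj).symm⟩, fun e he => hC2 e (hEC he),
    hEC.trans hCc, ?_, ?_, exists_mem_range_quaternionHom_conj hP hx hy hxy h4 h2 h⟩
  · rw [eq_bot_iff]
    rintro _ ⟨⟨i | i, rfl⟩, he⟩
    · obtain ⟨-, h5, h6⟩ := (hCmem _).1 (hEC he)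
      rw [Subgroup.mem_bot]
      rw [hf, quaternionHom_a] at *
      rcases pow_eq_of_commute h4 hxy h6.symm with h7 | h7
      · exact h7.1
      · rw [h7] at he; exact absurd he hzE
    · obtain ⟨-, h5, h6⟩ := (hCmem _).1 (hEC he)
      rw [hf, quaternionHom_xa, mul_assoc, ← pow_succ, pow_succ', ← mul_assoc, ← mul_assoc] at h5
      exact absurd (mul_right_cancel h5) hxy
  · apply le_antisymm (sup_le hfT (hEC.trans inf_le_left))
    intro t ht
    have hCle : C ≤ f.range ⊔ E := by
      intro c hc
      rcases hE c hc with h5 | h5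
      · exact Subgroup.mem_sup_right h5
      · have : c = c * x ^ 2 * (x ^ 2)⁻¹ := by group
        rw [this]
        exact mul_mem (Subgroup.mem_sup_right h5)
          (inv_mem (Subgroup.mem_sup_left (pow_mem hxr 2)))
    obtain ⟨k, hk, hkt⟩ := exists_mem_range_quaternionHom_conj hP hx hy hxy h4 h2 h t
    have hmem : t * k⁻¹ ∈ C := by
      refine (hCmem _).2 ⟨mul_mem ht (inv_mem (hfT hk)), ?_, ?_⟩
      · have := hkt x hxr
        calc x * (t * k⁻¹) = t * (t⁻¹ * x * t) * k⁻¹ := by group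
          _ = t * k⁻¹ * x := by rw [this]; group
      · have := hkt y hyr
        calc y * (t * k⁻¹) = t * (t⁻¹ * y * t) * k⁻¹ := by group
          _ = t * k⁻¹ * y := by rw [this]; group
    rw [← inv_mul_cancel_right t k]
    have := mul_mem (hCle hmem) (Subgroup.mem_sup_left (T := E) hk)
    simpa using this

/-- The structure of the torsion elements when they are fixed or inverted by `G`. -/
theorem torsion_structure (hG : IsHypercentral G) (hP : FixesOrInvertsTorsion G) :
    ∃ T : Subgroup G, IsTorsionSubgroup T ∧ (T ≤ Subgroup.center G ∨
      IsAbelianTwoGroupActedOnBySigns T ∨ IsQuaternionTimesElementary T) := by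
  refine ⟨torsionSubgroup hP, isTorsionSubgroup_torsionSubgroup hP, ?_⟩
  by_cases hc : torsionSubgroup hP ≤ Subgroup.center G
  · exact .inl hc
  by_cases hcomm : ∀ s ∈ torsionSubgroup hP, ∀ t ∈ torsionSubgroup hP, s * t = t * s
  · exact .inr (.inl (isAbelianTwoGroupActedOnBySigns hG hP hcomm hc))
  · push Not at hcomm
    obtain ⟨x, hx, y, hy, hxy⟩ := hcomm
    exact .inr (.inr (isQuaternionTimesElementary hP hx hy hxy))

end TorsionStructure

/-! ### Bicyclic units and normality of finite cyclic subgroups. -/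

section CyclicNormal
variable {G : Type*} [Group G]

lemma mem_upperCentralSeries_of_injective {H : Type*} [Group H] {f : G →* H}
    (hf : Function.Injective f) (n : ℕ) :
    ∀ x, f x ∈ Subgroup.upperCentralSeries H n → x ∈ Subgroup.upperCentralSeries G n := by
  induction n with
  | zero =>
    intro x hx
    rw [Subgroup.upperCentralSeries_zero, Subgroup.mem_bot] at hx ⊢
    exact (map_eq_one_iff f hf).1 hx
  | succ n ih =>
    intro x hx
    rw [Subgroup.mem_upperCentralSeries_succ_iff] at hx ⊢
    intro y
    apply ih
    rw [map_commutatorElement]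
    exact hx (f y)

lemma IsHypercentral.of_injective {H : Type*} [Group H] (hH : IsHypercentral H) {f : G →* H}
    (hf : Function.Injective f) : IsHypercentral G := by
  refine Set.eq_univ_of_forall fun x => ?_
  obtain ⟨n, hn⟩ := hH.exists_mem (f x)
  exact mem_hypercenter_iff.2 ⟨n, mem_upperCentralSeries_of_injective hf n x hn⟩

/-- Iterated commutators of an element of the `n`-th centre vanish after `n` steps. -/
lemma iterate_commutator_eq_one {w : G} (n : ℕ) : ∀ u : ℕ → G,
    u 0 ∈ Subgroup.upperCentralSeries G n → (∀ i, u (i + 1) = ⁅u i, w⁆) → u n = 1 := by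
  induction n with
  | zero => intro u h _; simpa using h
  | succ n ih =>
    intro u h hu
    refine ih (fun i => u (i + 1)) ?_ fun i => hu (i + 1)
    simp only [zero_add, hu 0]
    exact Subgroup.mem_upperCentralSeries_succ_iff.1 h w

lemma IsHypercentral.exists_iterate_eq_one (hG : IsHypercentral G) {w : G} (u : ℕ → G)
    (hu : ∀ i, u (i + 1) = ⁅u i, w⁆) : ∃ n, u n = 1 :=
  let ⟨n, hn⟩ := hG.exists_mem (u 0)
  ⟨n, iterate_commutator_eq_one n u hn hu⟩

/-- If v = (1 - t)a is fixed by t, then v*v = a*(1 - t⁻¹)v = 0, and positivity gives v = 0. -/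
lemma one_sub_single_mul_eq_zero {t : G} {a : ℤ[G]}
    (h : (1 - MonoidAlgebra.single t 1) * ((1 - MonoidAlgebra.single t 1) * a) = 0) :
    (1 - MonoidAlgebra.single t 1) * a = 0 := by
  set v : ℤ[G] := (1 - MonoidAlgebra.single t 1) * a with hv
  have h1 : MonoidAlgebra.single t 1 * v = v := by
    rw [sub_mul, one_mul, sub_eq_zero] at h
    exact h.symm
  have h2 : MonoidAlgebra.single t⁻¹ 1 * v = v := by
    conv_lhs => rw [← h1]
    rw [← mul_assoc, MonoidAlgebra.single_mul_single]
    simp [← MonoidAlgebra.one_def]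
  apply eq_zero_of_conj_mul
  rw [hv, conj_mul, ← hv, mul_assoc]
  simp [sub_mul, h2]

lemma pow_one_sub_single_mul_eq_zero {t : G} (n : ℕ) : ∀ {a : ℤ[G]},
    (1 - MonoidAlgebra.single t 1) ^ (n + 1) * a = 0 →
    (1 - MonoidAlgebra.single t 1) * a = 0 := by
  induction n with
  | zero => intro a h; simpa using h
  | succ n ih =>
    intro a h
    rw [pow_succ, mul_assoc] at h
    exact one_sub_single_mul_eq_zero (ih h)

/-- The sum of the powers of `t`. -/
noncomputable def powerSum (t : G) : ℤ[G] :=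
  ∑ i ∈ Finset.range (orderOf t), (MonoidAlgebra.single t (1 : ℤ)) ^ i

lemma single_pow_orderOf (t : G) : (MonoidAlgebra.single t (1 : ℤ)) ^ orderOf t = 1 := by
  rw [MonoidAlgebra.single_pow, pow_orderOf_eq_one, one_pow, MonoidAlgebra.one_def]

lemma powerSum_mul (t : G) : powerSum t * MonoidAlgebra.single t 1 = powerSum t := by
  have := geom_sum_mul (MonoidAlgebra.single t (1 : ℤ)) (orderOf t)
  rw [single_pow_orderOf, sub_self, mul_sub, mul_one, sub_eq_zero] at this
  exact this

lemma coeff_powerSum (t z : G) :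
    (powerSum t).coeff z = ∑ i ∈ Finset.range (orderOf t), (Finsupp.single (t ^ i) (1 : ℤ)) z := by
  rw [powerSum]
  simp [MonoidAlgebra.single_pow]

lemma coeff_powerSum_one {t : G} (ht : IsOfFinOrder t) : (powerSum t).coeff 1 ≠ 0 := by
  classical
  rw [coeff_powerSum]
  refine ne_of_gt (lt_of_lt_of_le one_pos ?_)
  have := Finset.single_le_sum (f := fun i => (Finsupp.single (t ^ i) (1 : ℤ)) 1)
    (fun i _ => by rw [Finsupp.single_apply]; split_ifs <;> simp)
    (Finset.mem_range.2 ht.orderOf_pos)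
  simpa using this

lemma exists_pow_of_coeff_powerSum {t z : G} (h : (powerSum t).coeff z ≠ 0) :
    ∃ i : ℕ, t ^ i = z := by
  rw [coeff_powerSum] at h
  obtain ⟨i, -, hi⟩ := Finset.exists_ne_zero_of_sum_ne_zero h
  refine ⟨i, ?_⟩
  by_contra hne
  exact hi (Finsupp.single_eq_of_ne (Ne.symm hne))

/-- Finite cyclic subgroups are normal: otherwise bicyclic units violate hypercentrality. -/
lemma exists_conj_eq_pow (hU : IsHypercentral (unitsOne G)) (g : G) {t : G}
    (ht : IsOfFinOrder t) : ∃ k : ℕ, g⁻¹ * t * g = t ^ k := by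
  set τ : ℤ[G] := MonoidAlgebra.single t 1 with hτ
  set y : ℤ[G] := MonoidAlgebra.single g 1 * powerSum t with hy
  have hyτ : y * τ = y := by rw [hy, mul_assoc, powerSum_mul]
  have hzero : ∀ i : ℕ, y * (1 - τ) ^ (i + 1) = 0 := fun i => by
    rw [pow_succ', ← mul_assoc, mul_sub, mul_one, hyτ, sub_self, zero_mul]
  let x : ℕ → ℤ[G] := fun i => (1 - τ) ^ (i + 1) * y
  have hxx : ∀ i j, x i * x j = 0 := fun i j => by
    simp only [x]
    rw [mul_assoc, ← mul_assoc y, hzero, zero_mul, mul_zero]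
  let U : ℕ → (ℤ[G])ˣ := fun i =>
    { val := 1 + x i
      inv := 1 - x i
      val_inv := by simp [add_mul, mul_sub, hxx]
      inv_val := by simp [sub_mul, mul_add, hxx] }
  have haug : ∀ i, U i ∈ unitsOne G := fun i => by
    rw [mem_unitsOne]
    change augmentation G (1 + (1 - τ) ^ (i + 1) * y) = 1
    simp [hτ, augmentation_single]
  -- Since x_i t = x_i and x_i x_j = 0, [1 + x_i, t] = 1 + x_i - t x_i = 1 + x_{i+1}.
  obtain ⟨n, hn⟩ := hU.exists_iterate_eq_one (w := toUnitsOne G t) (fun i => ⟨U i, haug i⟩) (by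
    intro i
    rw [commutatorElement_def, eq_mul_inv_iff_mul_eq, eq_mul_inv_iff_mul_eq]
    apply unitsOne_ext
    simp only [Subgroup.coe_mul, Units.val_mul, coe_toUnitsOne]
    change (1 + x (i + 1)) * τ * (1 + x i) = (1 + x i) * τ
    have hxτ : ∀ j, x j * τ = x j := fun j => by simp only [x]; rw [mul_assoc, hyτ]
    have hs : x (i + 1) = x i - τ * x i := by
      simp only [x]; rw [pow_succ' _ (i + 1), mul_assoc, sub_mul, one_mul]
    rw [add_mul 1 (x (i + 1)), add_mul 1 (x i), hxτ, hxτ, one_mul, add_mul, mul_add, mul_add, hxx,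
      hs]
    simp)
  have h1 : x n = 0 := by
    have := congrArg (fun u : unitsOne G => ((u : (ℤ[G])ˣ) : ℤ[G])) hn
    change 1 + x n = 1 at this
    simpa using this
  have h2 := pow_one_sub_single_mul_eq_zero n h1
  rw [sub_mul, one_mul, sub_eq_zero] at h2
  -- Now t g t̂ = g t̂. At tg the left coefficient is that of t̂ at 1, so g⁻¹tg lies in the support
  -- of t̂.
  have h3 := congrArg (fun a : ℤ[G] => a.coeff (t * g)) h2
  simp only [hy, MonoidAlgebra.coeff_single_mul_apply, one_mul, inv_mul_cancel_left,
    inv_mul_cancel] at h3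
  have h4 : (powerSum t).coeff (g⁻¹ * (t * g)) ≠ 0 := by
    rw [h3]; exact coeff_powerSum_one ht
  obtain ⟨k, hk⟩ := exists_pow_of_coeff_powerSum h4
  exact ⟨k, by rw [hk, mul_assoc]⟩

end CyclicNormal

/-! ### Chords of a regular polygon. -/

section Chord

/-- Chords of the regular `n`-gon are at least as long as its sides, with equality only for sides. -/
lemma norm_exp_sub_one_le {n s : ℕ} (hs : 0 < s) (hsn : s < n) :
    ‖Complex.exp (2 * Real.pi * Complex.I / n) - 1‖ ≤
        ‖Complex.exp (2 * Real.pi * Complex.I / n) ^ s - 1‖ ∧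
      (‖Complex.exp (2 * Real.pi * Complex.I / n) - 1‖ =
        ‖Complex.exp (2 * Real.pi * Complex.I / n) ^ s - 1‖ → s = 1 ∨ s + 1 = n) := by
  have hn : (0 : ℝ) < n := by exact_mod_cast hs.trans hsn
  have hpi := Real.pi_pos
  have hnorm : ∀ r : ℕ, 0 < r → r < n →
      ‖Complex.exp (2 * Real.pi * Complex.I / n) ^ r - 1‖ = 2 * Real.sin (Real.pi * r / n) := by
    intro r hr hrn
    have h1 : Complex.exp (2 * Real.pi * Complex.I / n) ^ r =
        Complex.exp (Complex.I * ((2 * Real.pi * r / n : ℝ) : ℂ)) := by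
      rw [← Complex.exp_nat_mul]; congr 1; push_cast; ring
    rw [h1, Complex.norm_exp_I_mul_ofReal_sub_one]
    have h2 : 2 * Real.pi * r / n / 2 = Real.pi * r / n := by ring
    rw [h2, Real.norm_eq_abs, abs_of_nonneg]
    have : Real.pi * r / n ≤ Real.pi := by
      rw [div_le_iff₀ hn]
      have : (r : ℝ) ≤ n := by exact_mod_cast hrn.le
      nlinarith
    have := Real.sin_nonneg_of_nonneg_of_le_pi (by positivity) this
    positivity
  have h1 := hnorm 1 one_pos (by omega)
  rw [pow_one] at h1
  rw [h1, hnorm s hs hsn]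
  have hmono := Real.strictMonoOn_sin
  have hn1 : Real.pi * (1 : ℕ) / n ∈ Set.Icc (-(Real.pi / 2)) (Real.pi / 2) := by
    constructor
    · have : 0 ≤ Real.pi * (1 : ℕ) / n := by positivity
      linarith
    · have : (2 : ℝ) ≤ n := by exact_mod_cast (show 2 ≤ n by omega)
      rw [div_le_div_iff₀ hn two_pos]
      push_cast
      nlinarith
  have key : ∀ r : ℕ, 0 < r → 2 * r ≤ n →
      Real.sin (Real.pi * (1 : ℕ) / n) ≤ Real.sin (Real.pi * r / n) ∧
        (Real.sin (Real.pi * (1 : ℕ) / n) = Real.sin (Real.pi * r / n) → r = 1) := by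
    intro r hr hrn
    have hr1 : Real.pi * r / n ∈ Set.Icc (-(Real.pi / 2)) (Real.pi / 2) := by
      constructor
      · have : 0 ≤ Real.pi * r / n := by positivity
        linarith
      · have : 2 * (r : ℝ) ≤ n := by exact_mod_cast hrn
        rw [div_le_div_iff₀ hn two_pos]
        nlinarith
    refine ⟨hmono.monotoneOn hn1 hr1 ?_, fun h => ?_⟩
    · have : ((1 : ℕ) : ℝ) ≤ r := by exact_mod_cast hr
      gcongr
    · have := hmono.injOn hn1 hr1 h
      rw [div_left_inj' hn.ne', mul_right_inj' hpi.ne'] at this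
      exact_mod_cast this.symm
  rcases le_total (2 * s) n with h | h
  · obtain ⟨k1, k2⟩ := key s hs h
    exact ⟨by linarith, fun e => .inl (k2 (by linarith))⟩
  · obtain ⟨k1, k2⟩ := key (n - s) (by omega) (by omega)
    have : Real.pi * (n - s : ℕ) / n = Real.pi - Real.pi * s / n := by
      rw [Nat.cast_sub hsn.le]; field_simp
    rw [this, Real.sin_pi_sub] at k1 k2
    exact ⟨by linarith, fun e => .inr (by have := k2 (by linarith); omega)⟩

end Chord

/-! ### Hoechsmann units. -/

section HoechsmannUnit
variable {R : Type*} [CommRing R]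

lemma geom_sum_pow_mul_geom_sum (c : R) (a k : ℕ) :
    (∑ i ∈ Finset.range a, (c ^ k) ^ i) * ∑ i ∈ Finset.range k, c ^ i =
      ∑ i ∈ Finset.range (k * a), c ^ i := by
  induction a with
  | zero => simp
  | succ a ih =>
    rw [Finset.sum_range_succ, add_mul, ih, Nat.mul_succ, Finset.sum_range_add, ← pow_mul,
      Finset.mul_sum]
    simp [pow_add]

lemma geom_sum_one_add_mul {c : R} {n : ℕ} (hc : c ^ n = 1) (q : ℕ) :
    ∑ i ∈ Finset.range (1 + n * q), c ^ i = 1 + q * ∑ i ∈ Finset.range n, c ^ i := by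
  induction q with
  | zero => simp
  | succ q ih =>
    have h : c * ∑ i ∈ Finset.range n, c ^ i = ∑ i ∈ Finset.range n, c ^ i := by
      have := mul_geom_sum c n
      rw [hc, sub_self, sub_mul, one_mul, sub_eq_zero] at this
      exact this
    rw [Nat.mul_succ, ← add_assoc, Finset.sum_range_add, ih]
    have : ∑ x ∈ Finset.range n, c ^ (1 + n * q + x) = c * ∑ i ∈ Finset.range n, c ^ i := by
      rw [Finset.mul_sum]
      refine Finset.sum_congr rfl fun i _ => ?_
      rw [pow_add, pow_add, pow_mul, hc]; simp
    rw [this, h]; push_cast; ring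

lemma pow_mul_geom_sum {c : R} {n : ℕ} (hc : c ^ n = 1) (i : ℕ) :
    c ^ i * ∑ i ∈ Finset.range n, c ^ i = ∑ i ∈ Finset.range n, c ^ i := by
  have h : c * ∑ i ∈ Finset.range n, c ^ i = ∑ i ∈ Finset.range n, c ^ i := by
    have := mul_geom_sum c n
    rw [hc, sub_self, sub_mul, one_mul, sub_eq_zero] at this
    exact this
  induction i with
  | zero => simp
  | succ i ih => rw [pow_succ, mul_assoc, h, ih]

lemma geom_sum_mul_geom_sum {c : R} {n : ℕ} (hc : c ^ n = 1) (a b : ℕ) :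
    (∑ i ∈ Finset.range a, (c ^ b) ^ i) * ∑ i ∈ Finset.range n, c ^ i =
      a * ∑ i ∈ Finset.range n, c ^ i := by
  rw [Finset.sum_mul]
  simp only [← pow_mul, pow_mul_geom_sum hc]
  simp

/-- Hoechsmann's unit attached to `a * k ≡ 1` modulo `n`. -/
def hoechsmannUnit {c : R} {n a k q : ℕ} (hc : c ^ n = 1) (hak : k * a = 1 + n * q) : Rˣ :=
  -- Formally the unit is (c - 1)²/((c^k - 1)(c^a - 1)), because c^(ka) = c, and the second factor
  -- is its inverse. Subtracting q times the norm element turns the augmentation ak into ak - nq =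
  -- 1.
  have key : ((∑ i ∈ Finset.range a, (c ^ k) ^ i) * (∑ i ∈ Finset.range k, (c ^ a) ^ i)
        - q * ∑ i ∈ Finset.range n, c ^ i) *
      ((∑ i ∈ Finset.range a, c ^ i) * (∑ i ∈ Finset.range k, c ^ i)
        - q * ∑ i ∈ Finset.range n, c ^ i) = 1 := by
    have h1 := geom_sum_pow_mul_geom_sum c a k
    have h2 := geom_sum_pow_mul_geom_sum c k a
    rw [hak, geom_sum_one_add_mul hc] at h1
    rw [mul_comm a, hak, geom_sum_one_add_mul hc] at h2
    have h3 := geom_sum_mul_geom_sum hc a k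
    have h4 := geom_sum_mul_geom_sum hc k a
    have h5 := geom_sum_mul_geom_sum hc a 1
    have h6 := geom_sum_mul_geom_sum hc k 1
    have h7 := geom_sum_mul_geom_sum hc n 1
    rw [pow_one] at h5 h6 h7
    have h8 : (k : R) * a = 1 + n * q := by exact_mod_cast congrArg (Nat.cast (R := R)) hak
    generalize (∑ i ∈ Finset.range n, c ^ i) = N at *
    generalize (∑ i ∈ Finset.range a, (c ^ k) ^ i) = A at *
    generalize (∑ i ∈ Finset.range k, (c ^ a) ^ i) = B at *
    generalize (∑ i ∈ Finset.range a, c ^ i) = A' at *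
    generalize (∑ i ∈ Finset.range k, c ^ i) = B' at *
    linear_combination (B * A') * h1 + (1 + q * N) * h2 - q * A * h4 - q * A' * h6 - q * k * h3
      - q * k * h5 + 2 * q ^ 2 * h7 - 2 * q * N * h8
  { val := _, inv := _, val_inv := key, inv_val := by rw [mul_comm]; exact key }

lemma coe_hoechsmannUnit {c : R} {n a k q : ℕ} (hc : c ^ n = 1) (hak : k * a = 1 + n * q) :
    (hoechsmannUnit hc hak : R) =
      (∑ i ∈ Finset.range a, (c ^ k) ^ i) * (∑ i ∈ Finset.range k, (c ^ a) ^ i)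
        - q * ∑ i ∈ Finset.range n, c ^ i := rfl

/-- The value of Hoechsmann's unit at a nontrivial root of unity. -/
lemma coe_hoechsmannUnit_mul {K : Type*} [Field K] {ζ : K} {n a k q : ℕ}
    (hak : k * a = 1 + n * q) (hζ : ζ ^ n = 1) (h1 : ζ ≠ 1) :
    ((∑ i ∈ Finset.range a, (ζ ^ k) ^ i) * (∑ i ∈ Finset.range k, (ζ ^ a) ^ i)
        - q * ∑ i ∈ Finset.range n, ζ ^ i) * ((ζ ^ k - 1) * (ζ ^ a - 1)) = (ζ - 1) ^ 2 := by
  have hN : ∑ i ∈ Finset.range n, ζ ^ i = 0 := by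
    have := geom_sum_mul ζ n
    rw [hζ, sub_self] at this
    exact (mul_eq_zero.1 this).resolve_right (sub_ne_zero.2 h1)
  have hcc : ζ ^ (k * a) = ζ := by rw [hak, pow_add, pow_mul, hζ]; simp
  have e1 := geom_sum_mul (ζ ^ k) a
  have e2 := geom_sum_mul (ζ ^ a) k
  rw [← pow_mul, hcc] at e1
  rw [← pow_mul, mul_comm a, hcc] at e2
  rw [hN, mul_zero, sub_zero]
  calc _ = ((∑ i ∈ Finset.range a, (ζ ^ k) ^ i) * (ζ ^ k - 1)) *
        ((∑ i ∈ Finset.range k, (ζ ^ a) ^ i) * (ζ ^ a - 1)) := by ring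
    _ = _ := by rw [e1, e2]; ring

end HoechsmannUnit

/-! ### Unipotent actions of finite order. -/

section Periodic

/-- A unipotent endomorphism of finite order preserves every additive invariant. -/
lemma additive_iterate_eq_of_unipotent {A : Type*} [CommGroup A] {s : A →* A} {m : ℕ} (hm : m ≠ 0)
    (hs : ∀ a, s^[m] a = a) {L : A → ℝ} (hL : ∀ a b, L (a * b) = L a + L b) (N : ℕ) :
    ∀ a, (fun a => a * (s a)⁻¹)^[N] a = 1 → ∀ i, L (s^[i] a) = L a := by
  have hL1 : L 1 = 0 := by simpa using hL 1 1
  have hLinv : ∀ a, L a⁻¹ = -L a := fun a => by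
    have := hL a a⁻¹
    rw [mul_inv_cancel, hL1] at this
    linarith
  have hs1 : ∀ i : ℕ, ∀ a b, s^[i] (a * b⁻¹) = s^[i] a * (s^[i] b)⁻¹ := fun i a b => by
    rw [iterate_map_mul, iterate_map_inv]
  induction N with
  | zero =>
    intro a ha i
    rw [Function.iterate_zero, id] at ha
    rw [ha, iterate_map_one]
  | succ N ih =>
    intro a ha i
    rw [Function.iterate_succ_apply] at ha
    have h := ih _ ha
    -- The induction hypothesis for a·s(a)⁻¹ makes the increments of L along the orbit constant.
    -- They sum to zero over a period, so each is zero.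
    have h1 : ∀ i, L (s^[i + 1] a) - L (s^[i] a) = -L (a * (s a)⁻¹) := fun i => by
      have := h i
      rw [hs1, hL, hLinv, ← Function.iterate_succ_apply] at this
      linarith
    have h2 := Finset.sum_range_sub (fun i => L (s^[i] a)) m
    simp only [h1, hs, Function.iterate_zero, id, sub_self, Finset.sum_const, Finset.card_range,
      nsmul_eq_mul] at h2
    have h3 : -L (a * (s a)⁻¹) = 0 :=
      (mul_eq_zero.1 h2).resolve_left (Nat.cast_ne_zero.2 hm)
    induction i with
    | zero => rfl
    | succ i ihi =>
      have := h1 i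
      linarith

end Periodic

/-! ### Automorphisms of finite cyclic subgroups induced by conjugation. -/

section Conjugation
variable {G C : Type*} [Group G] [CommGroup C]

lemma conj_mapDomain {ρ : C →* G} {g : G} {k : ℕ} (h : ∀ c, g⁻¹ * ρ c * g = ρ (c ^ k)) (p : ℤ[C]) :
    MonoidAlgebra.single g⁻¹ 1 * MonoidAlgebra.mapDomainRingHom ℤ ρ p * MonoidAlgebra.single g 1 =
      MonoidAlgebra.mapDomainRingHom ℤ ρ
        (MonoidAlgebra.mapDomainRingHom ℤ (powMonoidHom k : C →* C) p) := by
  induction p using MonoidAlgebra.induction_linear with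
  | zero => simp
  | add p q hp hq => simp only [map_add, mul_add, add_mul, hp, hq]
  | single c n => simp [MonoidAlgebra.single_mul_single, h]

/-- An element normalizing a commutative subgroup acts unipotently on its normalized units. -/
lemma exists_iterate_eq_one_of_conj (hU : IsHypercentral (unitsOne G)) {ρ : C →* G}
    (hρ : Function.Injective ρ) {g : G} {k : ℕ} (h : ∀ c, g⁻¹ * ρ c * g = ρ (c ^ k))
    (P : (ℤ[C])ˣ) (hP : augmentation G (MonoidAlgebra.mapDomainRingHom ℤ ρ P) = 1) :
    ∃ N, (fun a => a * (Units.map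
      (MonoidAlgebra.mapDomainRingHom ℤ (powMonoidHom k : C →* C) : ℤ[C] →* ℤ[C]) a)⁻¹)^[N] P
        = 1 := by
  set s : (ℤ[C])ˣ →* (ℤ[C])ˣ := Units.map
      (MonoidAlgebra.mapDomainRingHom ℤ (powMonoidHom k : C →* C) : ℤ[C] →* ℤ[C]) with hs
  let J : (ℤ[C])ˣ →* (ℤ[G])ˣ := Units.map (MonoidAlgebra.mapDomainRingHom ℤ ρ : ℤ[C] →* ℤ[G])
  have hJ : Function.Injective J :=
    Units.map_injective (MonoidAlgebra.mapDomain_injective hρ)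
  -- The inverse is taken so that Q ↦ wQw⁻¹ is t ↦ g⁻¹tg, and Q·s(Q)⁻¹ becomes the commutator [Q,
  -- w].
  let w : unitsOne G := toUnitsOne G g⁻¹
  have hconj : ∀ Q, (w : (ℤ[G])ˣ) * J Q * (w : (ℤ[G])ˣ)⁻¹ = J (s Q) := fun Q => by
    rw [mul_inv_eq_iff_eq_mul]
    have := conj_mapDomain h (Q : ℤ[C])
    apply Units.ext
    simp only [Units.val_mul]
    have hw : ((w : (ℤ[G])ˣ) : ℤ[G]) = MonoidAlgebra.single g⁻¹ 1 := rfl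
    rw [hw]
    change _ * MonoidAlgebra.mapDomainRingHom ℤ ρ (Q : ℤ[C]) = MonoidAlgebra.mapDomainRingHom ℤ ρ
      (MonoidAlgebra.mapDomainRingHom ℤ (powMonoidHom k : C →* C) Q) * _
    rw [← this, mul_assoc _ (MonoidAlgebra.single g 1), MonoidAlgebra.single_mul_single]
    simp [← MonoidAlgebra.one_def]
  have hcomm : ∀ Q, J (Q * (s Q)⁻¹) = ⁅J Q, (w : (ℤ[G])ˣ)⁆ := fun Q => by
    rw [map_mul, map_inv, ← hconj, commutatorElement_def]; group
  set D : (ℤ[C])ˣ → (ℤ[C])ˣ := fun a => a * (s a)⁻¹ with hD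
  have hmem : ∀ i, J (D^[i] P) ∈ unitsOne G := by
    intro i
    induction i with
    | zero => exact (mem_unitsOne G _).2 hP
    | succ i ih =>
      rw [Function.iterate_succ_apply', hD]
      simp only
      rw [hcomm, commutatorElement_def]
      exact mul_mem (mul_mem (mul_mem ih w.2) (inv_mem ih)) (inv_mem w.2)
  obtain ⟨N, hN⟩ := hU.exists_iterate_eq_one (w := w) (fun i => ⟨J (D^[i] P), hmem i⟩) (by
    intro i
    apply Subtype.ext
    simp only [Function.iterate_succ_apply']
    exact hcomm _)
  refine ⟨N, hJ ?_⟩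
  rw [map_one]
  exact congrArg Subtype.val hN

lemma iterate_map_powMonoidHom (k i : ℕ) (P : (ℤ[C])ˣ) :
    (((Units.map (MonoidAlgebra.mapDomainRingHom ℤ (powMonoidHom k : C →* C) : ℤ[C] →* ℤ[C]))^[i] P
      : (ℤ[C])ˣ) : ℤ[C]) =
      MonoidAlgebra.mapDomainRingHom ℤ (powMonoidHom (k ^ i) : C →* C) (P : ℤ[C]) := by
  induction i with
  | zero =>
    have : (powMonoidHom (k ^ 0) : C →* C) = MonoidHom.id C := by ext; simp
    rw [this, MonoidAlgebra.mapDomainRingHom_id]; rfl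
  | succ i ih =>
    rw [Function.iterate_succ_apply', Units.coe_map]
    have : (powMonoidHom (k ^ (i + 1)) : C →* C) =
        (powMonoidHom k).comp (powMonoidHom (k ^ i)) := by
      ext; simp [pow_succ, pow_mul]
    rw [this, MonoidAlgebra.mapDomainRingHom_comp, RingHom.comp_apply, ← ih]; rfl

lemma map_hoechsmannUnit {R S : Type*} [CommRing R] [Ring S] (F : R →+* S) {c : R} {n a k q : ℕ}
    (hc : c ^ n = 1) (hak : k * a = 1 + n * q) :
    F (hoechsmannUnit hc hak : R) =
      (∑ i ∈ Finset.range a, (F c ^ k) ^ i) * (∑ i ∈ Finset.range k, (F c ^ a) ^ i)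
        - q * ∑ i ∈ Finset.range n, F c ^ i := by
  rw [coe_hoechsmannUnit]
  simp

/-- An element inducing a power automorphism on a finite cyclic subgroup fixes or inverts it:
otherwise Hoechsmann units violate hypercentrality. -/
lemma eq_or_eq_inv_of_conj_eq_pow (hU : IsHypercentral (unitsOne G)) {ρ : C →* G}
    (hρ : Function.Injective ρ) {c : C} (hgen : ∀ x, x ∈ Subgroup.zpowers c)
    (hfin : IsOfFinOrder c) {g : G} {k : ℕ} (h : g⁻¹ * ρ c * g = ρ c ^ k) :
    c ^ k = c ∨ c ^ k = c⁻¹ := by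
  set n := orderOf c with hn
  have hn0 : 0 < n := hfin.orderOf_pos
  rcases Nat.lt_or_ge 1 n with hn1 | hn1
  swap
  · left
    have : c = 1 := orderOf_eq_one_iff.1 (by omega)
    rw [this, one_pow]
  have hcn : c ^ n = 1 := pow_orderOf_eq_one c
  have hconj : ∀ x, g⁻¹ * ρ x * g = ρ (x ^ k) := by
    intro x
    obtain ⟨i, rfl⟩ := Subgroup.mem_zpowers_iff.1 (hgen x)
    have := conj_zpow (a := g⁻¹) (b := ρ c) (i := i)
    rw [inv_inv] at this
    rw [map_zpow, ← this, h, ← zpow_natCast, ← zpow_natCast, map_zpow, map_zpow, ← zpow_mul, ← zpow_mul, mul_comm]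
  have hkn : k.Coprime n := by
    have h1 : orderOf (c ^ k) = n := by
      rw [← orderOf_injective ρ hρ, map_pow, ← h, hn, ← orderOf_injective ρ hρ c]
      have : SemiconjBy g (g⁻¹ * ρ c * g) (ρ c) := by
        rw [SemiconjBy]; group
      exact this.orderOf_eq _
    have hk0 : k ≠ 0 := by
      rintro rfl
      rw [pow_zero, orderOf_one] at h1
      omega
    rw [orderOf_pow' c hk0, ← hn] at h1
    rw [Nat.coprime_comm]
    have h2 := Nat.div_mul_cancel (Nat.gcd_dvd_left n k)
    rw [h1] at h2
    exact Nat.eq_of_mul_eq_mul_left hn0 (by rw [h2, mul_one])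
  obtain ⟨a, -, ha⟩ := Nat.exists_mul_mod_eq_one_of_coprime hkn hn1
  obtain ⟨q, hq⟩ : ∃ q, k * a = 1 + n * q := ⟨k * a / n, by
    conv_lhs => rw [← Nat.mod_add_div (k * a) n, ha]⟩
  have hcn' : (MonoidAlgebra.single c 1 : ℤ[C]) ^ n = 1 := by
    rw [MonoidAlgebra.single_pow, hcn, one_pow, MonoidAlgebra.one_def]
  set V : (ℤ[C])ˣ := hoechsmannUnit hcn' hq with hV
  obtain ⟨N, hN⟩ := exists_iterate_eq_one_of_conj hU hρ hconj V (by
    have := map_hoechsmannUnit ((augmentation G : ℤ[G] →+* ℤ).comp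
      (MonoidAlgebra.mapDomainRingHom ℤ ρ)) hcn' hq
    simp only [RingHom.comp_apply, MonoidAlgebra.mapDomainRingHom_apply,
      MonoidAlgebra.mapDomain_single, RingHom.coe_coe, augmentation_single] at this
    rw [MonoidAlgebra.mapDomainRingHom_apply, this]
    simp only [one_pow, Finset.sum_const, Finset.card_range, nsmul_eq_mul, mul_one]
    have hq' : (k : ℤ) * a = 1 + n * q := by exact_mod_cast hq
    linarith)
  set ζ : ℂ := Complex.exp (2 * Real.pi * Complex.I / n) with hζ
  have hprim : IsPrimitiveRoot ζ n := Complex.isPrimitiveRoot_exp n hn0.ne'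
  have hζn : ζ ^ n = 1 := hprim.pow_eq_one
  obtain ⟨ψ, hψ⟩ : ∃ ψ : C →* ℂ, ψ c = ζ := by
    have hord : orderOf (Units.mk0 ζ (hprim.ne_zero hn0.ne')) ∣ orderOf c := by
      rw [orderOf_dvd_iff_pow_eq_one, ← hn]
      apply Units.ext
      simpa using hζn
    refine ⟨(Units.coeHom ℂ).comp (monoidHomOfForallMemZpowers hgen hord), ?_⟩
    simp [monoidHomOfForallMemZpowers_apply_gen]
  let χ : ℤ[C] →+* ℂ := (MonoidAlgebra.lift ℤ ℂ C ψ : ℤ[C] →ₐ[ℤ] ℂ)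
  have hχ : χ (MonoidAlgebra.single c 1) = ζ := by
    change MonoidAlgebra.lift ℤ ℂ C ψ _ = ζ
    rw [MonoidAlgebra.lift_single, one_smul, hψ]
  have hmod : ∀ i j, i ≡ j [MOD n] → ζ ^ i = ζ ^ j := fun i j hij =>
    (pow_eq_pow_mod i hζn).trans ((congrArg (ζ ^ ·) hij).trans (pow_eq_pow_mod j hζn).symm)
  have hm0 : n.totient ≠ 0 := (Nat.totient_pos.2 hn0).ne'
  have hkm : k ^ n.totient ≡ 1 [MOD n] := Nat.ModEq.pow_totient hkn
  let L : (ℤ[C])ˣ → ℝ := fun P => Real.log ‖χ P‖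
  have hLmul : ∀ P Q, L (P * Q) = L P + L Q := fun P Q => by
    simp only [L]
    rw [Units.val_mul, map_mul, norm_mul, Real.log_mul]
    · exact norm_ne_zero_iff.2 (P.isUnit.map χ).ne_zero
    · exact norm_ne_zero_iff.2 (Q.isUnit.map χ).ne_zero
  have hconst := additive_iterate_eq_of_unipotent hm0 (fun P => by
    apply Units.ext
    rw [iterate_map_powMonoidHom]
    have : (powMonoidHom (k ^ n.totient) : C →* C) = MonoidHom.id C := by
      rw [MonoidHom.eq_iff_eq_on_generator hgen]
      change c ^ k ^ n.totient = c
      conv_rhs => rw [← pow_one c]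
      exact pow_eq_pow_iff_modEq.2 hkm
    rw [this, MonoidAlgebra.mapDomainRingHom_id]; rfl) hLmul N V hN
  let l : ℕ → ℝ := fun r => Real.log ‖ζ ^ r - 1‖
  have hne : ∀ r, r.Coprime n → ζ ^ r ≠ 1 := fun r hr e => by
    have := (hprim.pow_eq_one_iff_dvd r).1 e
    rw [Nat.Coprime, Nat.gcd_eq_right this] at hr
    omega
  have hki : ∀ i, (k ^ i).Coprime n := fun i => hkn.pow_left i
  have han : a.Coprime n := by
    rw [Nat.Coprime, ← Nat.dvd_one]
    have h1 : a.gcd n ∣ 1 + n * q := hq ▸ (Nat.gcd_dvd_left a n).mul_left k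
    exact (Nat.dvd_add_left ((Nat.gcd_dvd_right a n).mul_right q)).1 h1
  -- Evaluating s^i(V) at χ replaces ζ by ζ^(k^i); by unipotence its logarithm does not depend on i.
  have hval : ∀ i, 2 * l (k ^ i) - l (k ^ (i + 1)) - l (k ^ i * a) = L V := by
    intro i
    rw [← hconst i]
    simp only [L]
    rw [iterate_map_powMonoidHom]
    have h1 := map_hoechsmannUnit (χ.comp
      (MonoidAlgebra.mapDomainRingHom ℤ (powMonoidHom (k ^ i) : C →* C))) hcn' hq
    have h2 : (χ.comp (MonoidAlgebra.mapDomainRingHom ℤ (powMonoidHom (k ^ i) : C →* C)))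
        (MonoidAlgebra.single c 1) = ζ ^ k ^ i := by
      rw [← hχ, ← map_pow, MonoidAlgebra.single_pow, RingHom.comp_apply]
      simp
    have hi : (ζ ^ k ^ i) ^ n = 1 := by rw [← pow_mul, mul_comm, pow_mul, hζn, one_pow]
    have h3 := coe_hoechsmannUnit_mul hq hi (hne _ (hki i))
    rw [h2] at h1
    rw [← h1, RingHom.comp_apply, ← pow_mul, ← pow_mul, ← pow_succ] at h3
    have h4 := congrArg (fun z : ℂ => Real.log ‖z‖) h3
    have n0 : χ (MonoidAlgebra.mapDomainRingHom ℤ (powMonoidHom (k ^ i) : C →* C) V) ≠ 0 :=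
      ((V.isUnit.map _).map χ).ne_zero
    have n1 : ζ ^ k ^ (i + 1) - 1 ≠ 0 := sub_ne_zero.2 (hne _ (hki _))
    have n2 : ζ ^ (k ^ i * a) - 1 ≠ 0 := sub_ne_zero.2 (hne _ ((hki i).mul_left han))
    simp only [norm_mul, norm_pow] at h4
    rw [Real.log_mul (norm_ne_zero_iff.2 n0) (mul_ne_zero (norm_ne_zero_iff.2 n1)
      (norm_ne_zero_iff.2 n2)), Real.log_mul (norm_ne_zero_iff.2 n1) (norm_ne_zero_iff.2 n2),
      Real.log_pow] at h4
    push_cast at h4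
    simp only [l]
    linarith
  -- As a is inverse to k modulo n, the previous relation at i + 1 is a second difference of i ↦
  -- l(k^i). Summing over the period φ(n) forces L V = 0.
  have hstep : ∀ i, (l (k ^ (i + 1)) - l (k ^ (i + 1 + 1))) - (l (k ^ i) - l (k ^ (i + 1)))
      = L V := by
    intro i
    have h1 : l (k ^ (i + 1) * a) = l (k ^ i) := by
      simp only [l]
      have : ζ ^ (k ^ (i + 1) * a) = ζ ^ k ^ i := by
        rw [pow_succ, mul_assoc, hq]
        apply hmod
        have : k ^ i * (1 + n * q) = k ^ i + n * (k ^ i * q) := by ring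
        rw [this]
        exact Nat.add_mul_mod_self_left _ _ _
      rw [this]
    have := hval (i + 1)
    rw [h1] at this
    linarith
  have hsum := Finset.sum_range_sub (fun i => l (k ^ i) - l (k ^ (i + 1))) n.totient
  simp only [hstep, Finset.sum_const, Finset.card_range, nsmul_eq_mul] at hsum
  have hper : ∀ i, l (k ^ (n.totient + i)) = l (k ^ i) := fun i => by
    simp only [l]
    rw [hmod (k ^ (n.totient + i)) (k ^ i)]
    rw [pow_add]
    simpa using hkm.mul_right (k ^ i)
  have hp0 := hper 0
  have hp1 := hper 1
  rw [add_zero] at hp0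
  rw [hp0, hp1, zero_add, sub_self] at hsum
  have hLV : L V = 0 := (mul_eq_zero.1 hsum).resolve_left (Nat.cast_ne_zero.2 hm0)
  have hfinal := hval 0
  rw [hLV, pow_zero, zero_add, pow_one, one_mul] at hfinal
  have hchord : ∀ r, r.Coprime n → ‖ζ - 1‖ ≤ ‖ζ ^ r - 1‖ ∧
      (‖ζ - 1‖ = ‖ζ ^ r - 1‖ → r % n = 1 ∨ r % n + 1 = n) := by
    intro r hr
    rw [hmod r (r % n) (Nat.mod_modEq r n).symm]
    refine norm_exp_sub_one_le (Nat.pos_of_ne_zero fun e => ?_) (Nat.mod_lt _ hn0)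
    have := Nat.dvd_of_mod_eq_zero e
    rw [Nat.Coprime, Nat.gcd_eq_right this] at hr
    omega
  have hpos : 0 < ‖ζ - 1‖ := norm_pos_iff.2 (sub_ne_zero.2 (by
    simpa using hne 1 (Nat.coprime_one_left n)))
  have hk1 := hchord k hkn
  have ha1 := hchord a han
  have hlk : Real.log ‖ζ - 1‖ ≤ l k := Real.log_le_log hpos hk1.1
  have hla : Real.log ‖ζ - 1‖ ≤ l a := Real.log_le_log hpos ha1.1
  have hl1 : l 1 = Real.log ‖ζ - 1‖ := by simp only [l, pow_one]
  -- Now 2 l(1) = l(k) + l(a) with both terms at least l(1), so equality holds in each.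
  have heq : ‖ζ - 1‖ = ‖ζ ^ k - 1‖ := by
    refine Real.log_injOn_pos hpos (hpos.trans_le hk1.1) ?_
    change _ = l k
    linarith
  rcases hk1.2 heq with e | e
  · left
    rw [← pow_mod_orderOf, ← hn, e, pow_one]
  · right
    rw [eq_inv_iff_mul_eq_one, ← pow_mod_orderOf, ← hn, ← pow_succ, e, hcn]

end Conjugation

/-- If the normalized units are hypercentral, `G` fixes or inverts its torsion elements. -/
theorem fixesOrInvertsTorsion_of_isHypercentral {G : Type*} [Group G]
    (hU : IsHypercentral (unitsOne G)) : FixesOrInvertsTorsion G := by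
  intro g t ht
  obtain ⟨k, hk⟩ := exists_conj_eq_pow hU g ht
  let _ : CommGroup (Subgroup.zpowers t) :=
    { (inferInstance : Group (Subgroup.zpowers t)) with
      mul_comm := fun a b => by
        obtain ⟨_, i, rfl⟩ := a
        obtain ⟨_, j, rfl⟩ := b
        exact Subtype.ext (zpow_mul_comm t i j) }
  let c : Subgroup.zpowers t := ⟨t, Subgroup.mem_zpowers t⟩
  have hgen : ∀ x, x ∈ Subgroup.zpowers c := by
    rintro ⟨_, i, rfl⟩
    exact ⟨i, Subtype.ext (by simp [c])⟩
  have h := eq_or_eq_inv_of_conj_eq_pow hU (ρ := (Subgroup.zpowers t).subtype)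
    Subtype.val_injective (c := c) hgen
    ((Subgroup.zpowers t).subtype_injective.isOfFinOrder_iff (f := (Subgroup.zpowers t).subtype)
      |>.1 ht) (g := g) (k := k) hk
  rw [hk]
  rcases h with h | h
  · exact .inl (congrArg Subtype.val h)
  · exact .inr (congrArg Subtype.val h)

end UnitHypercentral

theorem theorem2p3 (G : Type*) [Group G] :
    UnitHypercentral.IsHypercentral (UnitHypercentral.unitsOne G) ↔
      UnitHypercentral.IsHypercentral G ∧
        ∃ T : Subgroup G, UnitHypercentral.IsTorsionSubgroup T ∧
          (T ≤ Subgroup.center G ∨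
            UnitHypercentral.IsAbelianTwoGroupActedOnBySigns T ∨
            UnitHypercentral.IsQuaternionTimesElementary T) := by
  constructor
  · intro hU
    have hG := hU.of_injective UnitHypercentral.toUnitsOne_injective
    exact ⟨hG, UnitHypercentral.torsion_structure hG
      (UnitHypercentral.fixesOrInvertsTorsion_of_isHypercentral hU)⟩
  · rintro ⟨hG, T, hT, h⟩
    obtain ⟨hP, m, hm⟩ := UnitHypercentral.exists_sq_mem_upperCentralSeries hG hT h
    have := hT.normal
    exact UnitHypercentral.isHypercentral_unitsOne hG hP hT hm
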